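/- Let $a_1a_2\cdots$ be a sequence of non-negative integers. The alternating lexicographic order is defined, for sequences with $x_1\cdots x_{k-1}=y_1\cdots y_{k-1}$ and $x_k\neq y_k$, by $x_1x_2\cdots<_{\mathrm{alt}}y_1y_2\cdots$ if and only if $x_k<y_k$ when $k$ is odd, and $y_k<x_k$ when $k$ is even. Let $u_1u_2\cdots=100111001\cdots$ be the sequence starting with $\varphi^n(1)$ for all $n\ge0$, where $\varphi$ is the morphism of words on $\{0,1\}$ with $\varphi(1)=100$, $\varphi(0)=1$. Write $\overline{w}$ for the periodic sequence $www\cdots$, and $\{v,w\}^\omega$ for the set of infinite concatenations of the blocks $v$ and $w$ (blocks are words of integers). Consider the conditions (A) $a_ka_{k+1}\cdots\le_{\mathrm{alt}}a_1a_2\cdots$ for all $k\ge2$; (B) $a_1a_2\cdots>_{\mathrm{alt}}u_1u_2\cdots$; (C) $a_1a_2\cdots\notin\{a_1\cdots a_k,\ a_1\cdots a_{k-1}(a_k-1)0\}^\omega\setminus\{\overline{a_1\cdots a_k}\}$ for all $k\ge1$ with $\overline{a_1\cdots a_k}>_{\mathrm{alt}}u_1u_2\cdots$; (D) $a_1a_2\cdots\notin\{a_1\cdots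 a_k0,\ a_1\cdots a_{k-1}(a_k+1)\}^\omega$ for all $k\ge1$ with $\overline{a_1\cdots a_{k-1}(a_k+1)}>_{\mathrm{alt}}u_1u_2\cdots$. For $\beta>1$, the itinerary of $1$ under the map $\widetilde T_{-\beta}:(0,1]\to(0,1]$, $x\mapsto-\beta x+\lfloor\beta x\rfloor+1$, is the sequence $\lfloor\beta\,\widetilde T_{-\beta}^{\,n-1}(1)\rfloor$, $n\ge1$. 1. If (A) and (B) hold, then there exists a unique $\beta>1$ such that $$-\sum_{j=1}^\infty\frac{a_j+1}{(-\beta)^j}=1\quad\text{and}\quad-\sum_{j=1}^\infty\frac{a_{k+j}+1}{(-\beta)^j}\in[0,1]\ \text{ for all }k\ge1$$ (these series converge). Moreover, for this $\beta$, one has $\sum_{j=1}^\infty\frac{a_{k+j}+1}{(-\beta)^j}\neq0$ for all $k\ge1$ if and only if (C) and (D) hold; equivalently, if and only if $a_1a_2\cdots$ is the itinerary of $1$ under $\widetilde T_{-\beta}$. 2. The sequence $a_1a_2\cdots$ is the itinerary of $1$ under $\widetilde T_{-\beta}$ for some $\beta>1$ if and only if (A), (B), (C) and (D) hold. -/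

import Mathlib

/-!
Sequences `a₁ a₂ ⋯` are functions `a : ℕ → ℤ` indexed from `0`, so the entry `a₍ᵢ₊₁₎` is `a i`.
-/

noncomputable section

namespace NegBeta

/-- The strict alternating lexicographic order.  With indices from `0`, the first differing position
`k` is the `(k+1)`-st entry, hence an odd position exactly when `k` is even. -/
def AltLT (x y : ℕ → ℤ) : Prop :=
  ∃ k : ℕ, (∀ i < k, x i = y i) ∧ ((Even k ∧ x k < y k) ∨ (Odd k ∧ y k < x k))

/-- The alternating lexicographic order. -/
def AltLE (x y : ℕ → ℤ) : Prop := AltLT x y ∨ x = y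

/-- The morphism of words `φ(1) = 100`, `φ(0) = 1`. -/
def phi (w : List ℤ) : List ℤ := w.flatMap fun d => if d = 1 then [1, 0, 0] else [1]

/-- The sequence `u₁ u₂ ⋯` that starts with `φⁿ(1)` for all `n`
(see `u_spec`; the word `φⁿ(1)` has more than `n` letters). -/
def u (n : ℕ) : ℤ := (phi^[n] [1]).getD n 0

/-- Every tail `a_k a_{k+1} ⋯`, `k ≥ 2`, is at most `a₁ a₂ ⋯` in the alternating order. -/
def TailsLE (a : ℕ → ℤ) : Prop := ∀ k : ℕ, 1 ≤ k → AltLE (fun n => a (k + n)) a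

/-- The sequence is larger than `u₁ u₂ ⋯` in the alternating order. -/
def AboveU (a : ℕ → ℤ) : Prop := AltLT u a

/-- The purely periodic sequence `w w w ⋯`, for a non-empty word `w`. -/
def periodic (w : List ℤ) : ℕ → ℤ := fun n => w.getD (n % w.length) 0

/-- `x ∈ W^ω`: the sequence `x` is an infinite concatenation of (non-empty) words from `W`.
The `p i` are the positions at which the blocks begin. -/
def IsConcat (W : Set (List ℤ)) (x : ℕ → ℤ) : Prop :=
  ∃ p : ℕ → ℕ, p 0 = 0 ∧ StrictMono p ∧ ∀ i : ℕ, (List.Ico (p i) (p (i + 1))).map x ∈ W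

/-- The prefix `a₁ ⋯ a_k`. -/
def pre (a : ℕ → ℤ) (k : ℕ) : List ℤ := (List.range k).map a

/-- For all `k ≥ 1` such that the periodic sequence with period `a₁ ⋯ a_k` is above `u`, the
sequence `a` is not in `{a₁ ⋯ a_k, a₁ ⋯ a_{k-1} (a_k - 1) 0}^ω`, unless it is that periodic
sequence. -/
def Cond1 (a : ℕ → ℤ) : Prop :=
  ∀ k : ℕ, 1 ≤ k → AltLT u (periodic (pre a k)) →
    ¬ (IsConcat {pre a k, pre a (k - 1) ++ [a (k - 1) - 1, 0]} a ∧ a ≠ periodic (pre a k))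

/-- For all `k ≥ 1` such that the periodic sequence with period `a₁ ⋯ a_{k-1} (a_k + 1)` is above
`u`, the sequence `a` is not in `{a₁ ⋯ a_k 0, a₁ ⋯ a_{k-1} (a_k + 1)}^ω`. -/
def Cond2 (a : ℕ → ℤ) : Prop :=
  ∀ k : ℕ, 1 ≤ k → AltLT u (periodic (pre a (k - 1) ++ [a (k - 1) + 1])) →
    ¬ IsConcat {pre a k ++ [0], pre a (k - 1) ++ [a (k - 1) + 1]} a

/-- The term `(a_{k+j} + 1) / (-β)^j` for `j ≥ 1`, where `j` is shifted to start at `0`. -/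
def term (β : ℝ) (a : ℕ → ℤ) (k j : ℕ) : ℝ := ((a (k + j) : ℝ) + 1) / (-β) ^ (j + 1)

/-- The tail sum `∑_{j ≥ 1} (a_{k+j} + 1) / (-β)^j`. -/
def tailSum (β : ℝ) (a : ℕ → ℤ) (k : ℕ) : ℝ := ∑' j : ℕ, term β a k j

/-- `β > 1`, `-∑ (a_j + 1) / (-β)^j = 1`, and
`-∑ (a_{k+j} + 1) / (-β)^j ∈ [0, 1]` for all `k ≥ 1`. -/
def IsBase (β : ℝ) (a : ℕ → ℤ) : Prop :=
  1 < β ∧ -tailSum β a 0 = 1 ∧ ∀ k : ℕ, 1 ≤ k → -tailSum β a k ∈ Set.Icc (0 : ℝ) 1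

/-- The map `x ↦ -βx + ⌊βx⌋ + 1`. -/
def negMap (β x : ℝ) : ℝ := -β * x + (⌊β * x⌋ : ℝ) + 1

/-- `a` is the itinerary of `1` under `negMap β`: the `n`-th entry is `⌊β T^{n-1}(1)⌋`. -/
def IsItinerary (β : ℝ) (a : ℕ → ℤ) : Prop := ∀ n : ℕ, a n = ⌊β * (negMap β)^[n] 1⌋

/-- `negMap β` takes values in `(0, 1]`. -/
theorem negMap_mem (β x : ℝ) : negMap β x ∈ Set.Ioc (0 : ℝ) 1 := by
  unfold negMap
  have h1 := Int.floor_le (β * x)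
  have h2 := Int.lt_floor_add_one (β * x)
  constructor <;> linarith

theorem phi_append (v w : List ℤ) : phi (v ++ w) = phi v ++ phi w := by
  simp [phi]

theorem phi_iter_append (n : ℕ) (v w : List ℤ) :
    phi^[n] (v ++ w) = phi^[n] v ++ phi^[n] w := by
  induction n generalizing v w with
  | zero => rfl
  | succ n ih => simp only [Function.iterate_succ, Function.comp_apply, phi_append, ih]

theorem phi_iter_succ (n : ℕ) : phi^[n + 1] [1] = phi^[n] [1] ++ phi^[n] [0, 0] := by
  rw [← phi_iter_append, Function.iterate_succ, Function.comp_apply]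
  rfl

theorem length_le_phi (w : List ℤ) : w.length ≤ (phi w).length := by
  induction w with
  | nil => simp
  | cons d w ih =>
    have h : phi (d :: w) = phi [d] ++ phi w := phi_append [d] w
    have h1 : 1 ≤ (phi [d]).length := by
      by_cases hd : d = 1 <;> simp [phi, hd]
    rw [h, List.length_append, List.length_cons]
    omega

theorem length_le_phi_iter (n : ℕ) (w : List ℤ) : w.length ≤ (phi^[n] w).length := by
  induction n with
  | zero => simp
  | succ n ih =>
    rw [Function.iterate_succ_apply']
    exact ih.trans (length_le_phi _)

theorem lt_length_phi_iter (n : ℕ) : n < (phi^[n] [1]).length := by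
  induction n with
  | zero => simp
  | succ n ih =>
    have h := length_le_phi_iter n [0, 0]
    rw [phi_iter_succ, List.length_append]
    simp only [List.length_cons, List.length_nil] at h
    omega

theorem phi_iter_prefix {m n : ℕ} (h : m ≤ n) : phi^[m] [1] <+: phi^[n] [1] := by
  induction n, h using Nat.le_induction with
  | base => exact List.prefix_refl _
  | succ n _ ih => exact ih.trans ⟨_, (phi_iter_succ n).symm⟩

/-- The sequence `u` starts with `φⁿ(1)` for every `n`. -/
theorem u_spec (n i : ℕ) (hi : i < (phi^[n] [1]).length) : u i = (phi^[n] [1])[i] := by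
  have h1 := lt_length_phi_iter i
  unfold u
  rw [List.getD_eq_getElem _ _ h1]
  rcases le_total i n with h | h
  · exact (phi_iter_prefix h).getElem h1
  · exact ((phi_iter_prefix h).getElem hi).symm

end NegBeta

end

noncomputable section

namespace NegBeta

open Filter Topology MeasureTheory

/-! A number `β > 1` is a base for `a` exactly when the points 1, `a 0 + 1 - β`, … of `orbit β a`
stay in [0, 1] (`isBase_iff`). Such an orbit follows `negMap β` until it hits 0 at a moment when
`negMap β` yields 1 (`orbit_step`), so `a` is the itinerary of 1 exactly when 0 is avoided.

Existence (`exists_base`): an orbit that leaves [0, 1] does so on a side showing that the base is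
too large or too small. Each kind of base forms an open set, because `TailsLE` forces an orbit that
touches 0 or 1 to leave later on the matching side. Large bases are too large. Bases near 1 are too
small by `AboveU`, since there the orbit prescribed by `u` stays in (0, 1) for a long time.
Connectedness of (1, ∞) leaves room for a base.

Role of `u`: for `1 < β < 2` the motion of 1 is renormalized by φ (`Renorm`), and this stops after
finitely many steps. The blocks read at that stage give `aboveU_itin`, and they show that a return
of 1 to itself at time `m` needs `β ^ m ≥ 2`.

Uniqueness (`isBase_unique`): if `β < γ` were both bases, put G(y) = ∑ (-1/γ)^k over those k whose
point of the `β`-orbit exceeds y. Summing G over the preimages of x under the branches gives γ G(x),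
but this summation multiplies the integral of |G| over [0, 1] by at most `β`. So G = 0 almost
everywhere, and its left limit at 1, the sum of (-1/γ)^k over the visits to 1, vanishes. The visit k
= 0 contributes 1, and the rest is smaller than 1 because of the bound on return times.

Visits to 0: after one, 1 is periodic under `negMap β`, and `a` is a concatenation of the period and
its variant through 0, so `Cond1` or `Cond2` fails. Conversely, the base of the periodic sequence in
a violated condition is also a base for such a concatenation, hence by uniqueness the base of `a`,
and the variant block passes through 0. For `Cond2` the periodic sequence may fail `TailsLE`; then
`a` violates the condition for a shorter word. -/

/-! ### The alternating order. -/

/-- Removing a prefix of odd length changes the parity of the first difference and so reverses the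
order. It is applied to the words φⁿ(0) and φⁿ(1), which have odd length. -/
theorem altLT_of_prefix_odd {x y : ℕ → ℤ} {n : ℕ} (hn : Odd n) (h : ∀ i < n, x i = y i)
    (hlt : AltLT (fun i => y (n + i)) (fun i => x (n + i))) : AltLT x y := by
  obtain ⟨k, hk, hd⟩ := hlt
  refine ⟨n + k, fun i hi => ?_, ?_⟩
  · rcases lt_or_ge i n with h1 | h1
    · exact h i h1
    · have := hk (i - n) (by omega)
      simpa [Nat.add_sub_cancel' h1] using this.symm
  · rcases hd with ⟨hk, hd⟩ | ⟨hk, hd⟩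
    · exact Or.inr ⟨hn.add_even hk, hd⟩
    · exact Or.inl ⟨hn.add_odd hk, hd⟩

theorem AltLT.trans {x y z : ℕ → ℤ} (hxy : AltLT x y) (hyz : AltLT y z) : AltLT x z := by
  obtain ⟨k, hk, hd⟩ := hxy
  obtain ⟨l, hl, he⟩ := hyz
  rcases lt_trichotomy k l with h | h | h
  · refine ⟨k, fun i hi => (hk i hi).trans (hl i (hi.trans h)), ?_⟩
    rw [← hl k h]; exact hd
  · subst h
    refine ⟨k, fun i hi => (hk i hi).trans (hl i hi), ?_⟩
    rcases hd with ⟨h1, h2⟩ | ⟨h1, h2⟩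
    · rcases he with ⟨h3, h4⟩ | ⟨h3, h4⟩
      · exact Or.inl ⟨h1, h2.trans h4⟩
      · exact absurd h1 (Nat.not_even_iff_odd.2 h3)
    · rcases he with ⟨h3, h4⟩ | ⟨h3, h4⟩
      · exact absurd h3 (Nat.not_even_iff_odd.2 h1)
      · exact Or.inr ⟨h1, h4.trans h2⟩
  · refine ⟨l, fun i hi => (hk i (hi.trans h)).trans (hl i hi), ?_⟩
    rw [hk l h]; exact he

/-- Two sequences with `x ≤ y` that agree before `n` satisfy the weak inequality at `n`. -/
theorem AltLE.digit {x y : ℕ → ℤ} (h : AltLE x y) {n : ℕ} (hn : ∀ i < n, x i = y i) :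
    (Even n → x n ≤ y n) ∧ (Odd n → y n ≤ x n) := by
  rcases h with ⟨k, hk, hd⟩ | rfl
  · rcases lt_trichotomy k n with h | rfl | h
    · have := hn k h
      omega
    · rcases hd with ⟨h1, h2⟩ | ⟨h1, h2⟩
      · exact ⟨fun _ => h2.le, fun h3 => absurd h1 (Nat.not_even_iff_odd.2 h3)⟩
      · exact ⟨fun h3 => absurd h3 (Nat.not_even_iff_odd.2 h1), fun _ => h2.le⟩
    · have := hk n h
      exact ⟨fun _ => this.le, fun _ => this.ge⟩
  · exact ⟨fun _ => le_rfl, fun _ => le_rfl⟩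

/-- A weak inequality between two sequences is decided at any position where they first differ. -/
theorem AltLE.altLT_at {x y : ℕ → ℤ} (h : AltLE x y) {n : ℕ} (hn : ∀ i < n, x i = y i)
    (hne : x n ≠ y n) : (Even n ∧ x n < y n) ∨ (Odd n ∧ y n < x n) := by
  have h1 := h.digit hn
  rcases Nat.even_or_odd n with h2 | h2
  · exact Or.inl ⟨h2, lt_of_le_of_ne (h1.1 h2) hne⟩
  · exact Or.inr ⟨h2, lt_of_le_of_ne (h1.2 h2) hne.symm⟩

theorem exists_first_ne {x y : ℕ → ℤ} (h : x ≠ y) : ∃ k, (∀ i < k, x i = y i) ∧ x k ≠ y k := by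
  classical
  have h1 : ∃ k, x k ≠ y k := Function.ne_iff.1 h
  exact ⟨Nat.find h1, fun i hi => not_not.1 (Nat.find_min h1 hi), Nat.find_spec h1⟩

theorem TailsLE.le_zero {a : ℕ → ℤ} (h : TailsLE a) (n : ℕ) : a n ≤ a 0 := by
  rcases Nat.eq_zero_or_pos n with rfl | hn
  · exact le_rfl
  · exact ((h n hn).digit (n := 0) (by simp)).1 (by simp)

/-! ### Prefixes and the words φⁿ(0), φⁿ(1). -/

/-- The sequence `s` starts with the word `w`. -/
def StartsWith (w : List ℤ) (s : ℕ → ℤ) : Prop := ∀ i (h : i < w.length), s i = w[i]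

theorem startsWith_append {v w : List ℤ} {s : ℕ → ℤ} :
    StartsWith (v ++ w) s ↔ StartsWith v s ∧ StartsWith w (fun i => s (v.length + i)) := by
  constructor
  · intro h
    refine ⟨fun i hi => ?_, fun i hi => ?_⟩
    · rw [h i (by simp; omega), List.getElem_append_left hi]
    · show s (v.length + i) = _
      rw [h _ (by simp; omega), List.getElem_append_right (by omega)]
      simp
  · rintro ⟨h1, h2⟩ i hi
    rcases lt_or_ge i v.length with h | h
    · rw [List.getElem_append_left h, h1 i h]
    · have := h2 (i - v.length) (by simp at hi; omega)
      rw [List.getElem_append_right h, ← this]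
      simp [Nat.add_sub_cancel' h]

theorem StartsWith.of_prefix {v w : List ℤ} {s : ℕ → ℤ} (h : StartsWith w s) (hv : v <+: w) :
    StartsWith v s := by
  obtain ⟨t, rfl⟩ := hv
  exact (startsWith_append.1 h).1

theorem StartsWith.eq_of_lt {w : List ℤ} {x y : ℕ → ℤ} (hx : StartsWith w x) (hy : StartsWith w y) :
    ∀ i < w.length, x i = y i := fun i hi => (hx i hi).trans (hy i hi).symm

theorem phi_iter_succ_zero (n : ℕ) : phi^[n + 1] [0] = phi^[n] [1] := by
  rw [Function.iterate_succ_apply]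
  simp [phi]

theorem phi_iter_succ_one (n : ℕ) :
    phi^[n + 1] [1] = phi^[n] [1] ++ (phi^[n] [0] ++ phi^[n] [0]) := by
  rw [phi_iter_succ, ← phi_iter_append n [0] [0]]
  rfl

theorem odd_length_phi_iter (n : ℕ) :
    Odd (phi^[n] [0]).length ∧ Odd (phi^[n] [1]).length := by
  induction n with
  | zero => simp
  | succ n ih =>
    rw [phi_iter_succ_zero, phi_iter_succ_one, List.length_append, List.length_append]
    refine ⟨ih.2, ih.2.add_even ?_⟩
    exact Even.add_self _

theorem phi_iter_succ_prefix (n : ℕ) {s : ℤ} (hs : s = 0 ∨ s = 1) :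
    phi^[n] [1] <+: phi^[n + 1] [s] := by
  rcases hs with rfl | rfl
  · rw [phi_iter_succ_zero]
  · rw [phi_iter_succ_one]; exact List.prefix_append _ _

/-- The words `φⁿ(0)` and `φⁿ(1)` are ordered like the letters `0` and `1`. -/
theorem altLT_of_phi_iter (n : ℕ) {s : ℤ} (hs : s = 0 ∨ s = 1) {x y : ℕ → ℤ}
    (hx : StartsWith (phi^[n] [1]) x) (hy : StartsWith (phi^[n] [0] ++ phi^[n] [s]) y) :
    AltLT y x := by
  induction n generalizing s x y with
  | zero =>
    refine ⟨0, by simp, Or.inl ⟨by simp, ?_⟩⟩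
    have h1 := hx 0 (by simp)
    have h2 := hy 0 (by simp)
    simp at h1 h2
    omega
  | succ n ih =>
    rw [phi_iter_succ_zero] at hy
    rw [phi_iter_succ_one] at hx
    obtain ⟨hx1, hx2⟩ := startsWith_append.1 hx
    obtain ⟨hy1, hy2⟩ := startsWith_append.1 hy
    -- φⁿ⁺¹(0) = φⁿ(1) is a prefix of φⁿ⁺¹(1), so the block after it decides: φⁿ(1) on one side,
    -- φⁿ(0) φⁿ(0) on the other.
    refine altLT_of_prefix_odd (odd_length_phi_iter n).2 (hy1.eq_of_lt hx1) ?_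
    exact ih (Or.inl rfl) (hy2.of_prefix (phi_iter_succ_prefix n hs)) hx2

theorem startsWith_u (n : ℕ) : StartsWith (phi^[n] [1]) u := fun i hi => u_spec n i hi

/-- The start of `u`, in terms of `n`-fold images of letters. -/
theorem startsWith_u_six (n : ℕ) :
    StartsWith (phi^[n] [1] ++ (phi^[n] [0] ++ (phi^[n] [0] ++ (phi^[n] [1] ++
      (phi^[n] [1] ++ phi^[n] [1]))))) u := by
  have h : StartsWith (phi^[n] (phi^[3] [1])) u := by
    rw [← Function.iterate_add_apply]; exact startsWith_u _
  refine h.of_prefix ?_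
  simp only [← phi_iter_append]
  have : phi^[3] [1] = ([1] ++ ([0] ++ ([0] ++ ([1] ++ ([1] ++ [1]))))) ++ [0, 0, 1, 0, 0] := by
    simp [phi]
  rw [this, phi_iter_append n _ [0, 0, 1, 0, 0]]
  exact List.prefix_append _ _

/-! ### Orbits and tail sums. -/

/-- The orbit `1, a₁ + 1 - β, …` of the point `1` under the branches prescribed by `a`. -/
def orbit (β : ℝ) (a : ℕ → ℤ) : ℕ → ℝ
  | 0 => 1
  | n + 1 => a n + 1 - β * orbit β a n

theorem orbit_zero (β : ℝ) (a : ℕ → ℤ) : orbit β a 0 = 1 := rfl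

theorem orbit_succ (β : ℝ) (a : ℕ → ℤ) (n : ℕ) :
    orbit β a (n + 1) = a n + 1 - β * orbit β a n := rfl

theorem orbit_congr {β : ℝ} {a b : ℕ → ℤ} {n : ℕ} (h : ∀ i < n, a i = b i) :
    orbit β a n = orbit β b n := by
  induction n with
  | zero => rfl
  | succ n ih =>
    rw [orbit_succ, orbit_succ, ih fun i hi => h i (by omega), h n (by omega)]

theorem orbit_shift {β : ℝ} {a : ℕ → ℤ} {k : ℕ} (h : orbit β a k = 1) (n : ℕ) :
    orbit β (fun i => a (k + i)) n = orbit β a (k + n) := by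
  induction n with
  | zero => exact h.symm
  | succ n ih => rw [orbit_succ, ih]; rfl

theorem abs_term_le {β : ℝ} (hβ : 1 < β) {a : ℕ → ℤ} (ha : ∀ n, 0 ≤ a n) {M : ℤ}
    (hM : ∀ n, a n ≤ M) (k j : ℕ) : |term β a k j| ≤ (M + 1) * (1 / β) ^ (j + 1) := by
  have h1 : (0 : ℝ) ≤ a (k + j) := by exact_mod_cast ha _
  have h2 : (a (k + j) : ℝ) ≤ M := by exact_mod_cast hM _
  have h3 : (0 : ℝ) < β ^ (j + 1) := by positivity
  rw [term, abs_div, abs_pow, abs_neg, abs_of_pos (by linarith : (0 : ℝ) < β), abs_of_nonneg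
    (by linarith), one_div, inv_pow, div_eq_mul_inv]
  gcongr

theorem summable_geom_succ {β : ℝ} (hβ : 1 < β) (M : ℝ) :
    Summable fun j : ℕ => M * (1 / β) ^ (j + 1) := by
  refine Summable.mul_left _ ?_
  refine (summable_nat_add_iff 1).2 (summable_geometric_of_lt_one (by positivity) ?_)
  rw [div_lt_one (by linarith)]; exact hβ

theorem summable_term {β : ℝ} (hβ : 1 < β) {a : ℕ → ℤ} (ha : ∀ n, 0 ≤ a n) {M : ℤ}
    (hM : ∀ n, a n ≤ M) (k : ℕ) : Summable (term β a k) :=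
  Summable.of_norm_bounded (summable_geom_succ hβ (M + 1)) fun j => abs_term_le hβ ha hM k j

theorem abs_tailSum_le {β : ℝ} (hβ : 1 < β) {a : ℕ → ℤ} (ha : ∀ n, 0 ≤ a n) {M : ℤ}
    (hM : ∀ n, a n ≤ M) (k : ℕ) :
    |tailSum β a k| ≤ ∑' j : ℕ, ((M : ℝ) + 1) * (1 / β) ^ (j + 1) := by
  rw [tailSum, ← Real.norm_eq_abs]
  exact tsum_of_norm_bounded (summable_geom_succ hβ (M + 1)).hasSum
    fun j => abs_term_le hβ ha hM k j

theorem tailSum_succ {β : ℝ} (hβ : 1 < β) {a : ℕ → ℤ} (ha : ∀ n, 0 ≤ a n) {M : ℤ}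
    (hM : ∀ n, a n ≤ M) (k : ℕ) :
    -tailSum β a (k + 1) = a k + 1 - β * -tailSum β a k := by
  have hb : β ≠ 0 := by linarith
  have h1 : tailSum β a k = term β a k 0 + ∑' j, term β a k (j + 1) :=
    (summable_term hβ ha hM k).tsum_eq_zero_add
  have h2 : ∀ j, term β a k (j + 1) = term β a (k + 1) j * (-β)⁻¹ := fun j => by
    simp only [term]
    rw [show k + (j + 1) = k + 1 + j by ring, pow_succ (-β) (j + 1), div_mul_eq_div_div,
      div_eq_mul_inv _ (-β)]
  have h3 : tailSum β a k = (a k + 1) / (-β) + tailSum β a (k + 1) * (-β)⁻¹ := by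
    rw [h1, tsum_congr h2, tsum_mul_right]
    simp [term, tailSum]
  rw [h3]
  field_simp
  ring

theorem neg_tailSum_eq_orbit {β : ℝ} (hβ : 1 < β) {a : ℕ → ℤ} (ha : ∀ n, 0 ≤ a n) {M : ℤ}
    (hM : ∀ n, a n ≤ M) (h : -tailSum β a 0 = 1) (k : ℕ) : -tailSum β a k = orbit β a k := by
  induction k with
  | zero => exact h
  | succ k ih => rw [tailSum_succ hβ ha hM, ih, orbit_succ]

/-- The orbit and the negated tail sums obey the same recursion, so their difference is multiplied
by `-β` at each step. Both are bounded, hence the difference is 0. -/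
theorem neg_tailSum_zero {β : ℝ} (hβ : 1 < β) {a : ℕ → ℤ} (ha : ∀ n, 0 ≤ a n) {M : ℤ}
    (hM : ∀ n, a n ≤ M) (h : ∀ n, orbit β a n ∈ Set.Icc (0 : ℝ) 1) : -tailSum β a 0 = 1 := by
  set C := ∑' j : ℕ, ((M : ℝ) + 1) * (1 / β) ^ (j + 1)
  have h1 : ∀ k, orbit β a k - -tailSum β a k = (-β) ^ k * (1 - -tailSum β a 0) := fun k => by
    induction k with
    | zero => simp [orbit_zero]
    | succ k ih =>
      rw [tailSum_succ hβ ha hM, orbit_succ, pow_succ']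
      linear_combination (-β) * ih
  by_contra hne
  have hpos : 0 < |1 - -tailSum β a 0| := abs_pos.2 (sub_ne_zero.2 (Ne.symm hne))
  obtain ⟨n, hn⟩ := pow_unbounded_of_one_lt ((1 + C) / |1 - -tailSum β a 0|) hβ
  rw [div_lt_iff₀ hpos] at hn
  have h2 := congrArg abs (h1 n)
  rw [abs_mul, abs_pow, abs_neg, abs_of_pos (by linarith : 0 < β)] at h2
  have h3 := abs_tailSum_le hβ ha hM n
  have h4 : |orbit β a n - -tailSum β a n| ≤ |orbit β a n| + |tailSum β a n| := by
    have := abs_sub (orbit β a n) (-tailSum β a n)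
    rwa [abs_neg] at this
  have h5 : |orbit β a n| ≤ 1 := abs_le.2 ⟨by linarith [(h n).1], (h n).2⟩
  linarith

theorem isBase_iff {β : ℝ} {a : ℕ → ℤ} (ha : ∀ n, 0 ≤ a n) {M : ℤ} (hM : ∀ n, a n ≤ M) :
    IsBase β a ↔ 1 < β ∧ ∀ n, orbit β a n ∈ Set.Icc (0 : ℝ) 1 := by
  constructor
  · rintro ⟨hβ, h1, h2⟩
    refine ⟨hβ, fun n => ?_⟩
    rcases Nat.eq_zero_or_pos n with rfl | hn
    · simp [orbit_zero]
    · rw [← neg_tailSum_eq_orbit hβ ha hM h1]; exact h2 n hn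
  · rintro ⟨hβ, h⟩
    have h1 := neg_tailSum_zero hβ ha hM h
    exact ⟨hβ, h1, fun k _ => by rw [neg_tailSum_eq_orbit hβ ha hM h1]; exact h k⟩

/-! ### Itineraries under `negMap β`. -/

/-- The itinerary of `x` under `negMap β`. -/
def itin (β x : ℝ) (n : ℕ) : ℤ := ⌊β * (negMap β)^[n] x⌋

theorem itin_shift (β x : ℝ) (k : ℕ) :
    (fun i => itin β x (k + i)) = itin β ((negMap β)^[k] x) := by
  funext i
  simp only [itin]
  rw [add_comm, Function.iterate_add_apply]

theorem isItinerary_iff {β : ℝ} {a : ℕ → ℤ} : IsItinerary β a ↔ a = itin β 1 :=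
  ⟨fun h => funext h, fun h n => congrFun h n⟩

theorem iterate_negMap_mem (β : ℝ) (n : ℕ) : (negMap β)^[n] 1 ∈ Set.Ioc (0 : ℝ) 1 := by
  cases n with
  | zero => simp
  | succ n => rw [Function.iterate_succ_apply']; exact negMap_mem _ _

theorem orbit_itin (β : ℝ) (n : ℕ) : orbit β (itin β 1) n = (negMap β)^[n] 1 := by
  induction n with
  | zero => rfl
  | succ n ih =>
    rw [orbit_succ, ih, Function.iterate_succ_apply', negMap, itin]
    ring

/-- One step of an orbit in `[0, 1]` that has followed `negMap β` so far. -/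
theorem orbit_step {β : ℝ} {a : ℕ → ℤ} {n : ℕ} (h : orbit β a n = (negMap β)^[n] 1)
    (h1 : orbit β a (n + 1) ∈ Set.Icc (0 : ℝ) 1) :
    (a n = itin β 1 n ∧ orbit β a (n + 1) = (negMap β)^[n + 1] 1) ∨
      (a n = itin β 1 n - 1 ∧ orbit β a (n + 1) = 0 ∧ (negMap β)^[n + 1] 1 = 1) := by
  have h2 : orbit β a (n + 1) = (negMap β)^[n + 1] 1 + ((a n - itin β 1 n : ℤ) : ℝ) := by
    rw [← orbit_itin β (n + 1), orbit_succ, orbit_succ, orbit_itin, h]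
    push_cast; ring
  have h3 := iterate_negMap_mem β (n + 1)
  have h4 : a n - itin β 1 n < 1 := by
    have : ((a n - itin β 1 n : ℤ) : ℝ) < 1 := by linarith [h1.2, h3.1]
    exact_mod_cast this
  have h5 : -1 ≤ a n - itin β 1 n := by
    have : ((-1 : ℤ) : ℝ) ≤ ((a n - itin β 1 n : ℤ) : ℝ) := by
      push_cast at h2 ⊢; linarith [h1.1, h3.2]
    exact_mod_cast this
  rcases (by omega : a n - itin β 1 n = 0 ∨ a n - itin β 1 n = -1) with h6 | h6
  · left
    rw [h6] at h2
    exact ⟨by omega, by simpa using h2⟩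
  · right
    rw [h6] at h2
    push_cast at h2
    exact ⟨by omega, by linarith [h1.1, h3.2], by linarith [h1.1, h3.2]⟩

theorem orbit_ne_zero_iff {β : ℝ} {a : ℕ → ℤ} (h : ∀ n, orbit β a n ∈ Set.Icc (0 : ℝ) 1) :
    (∀ k, 1 ≤ k → orbit β a k ≠ 0) ↔ IsItinerary β a := by
  constructor
  · intro h1
    have h2 : ∀ n, orbit β a n = (negMap β)^[n] 1 := fun n => by
      induction n with
      | zero => rfl
      | succ n ih =>
        rcases orbit_step ih (h (n + 1)) with h3 | h3
        · exact h3.2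
        · exact absurd h3.2.1 (h1 _ (by omega))
    intro n
    rcases orbit_step (h2 n) (h (n + 1)) with h3 | h3
    · exact h3.1
    · exact absurd h3.2.1 (h1 _ (by omega))
  · intro h1 k _
    rw [isItinerary_iff.1 h1, orbit_itin]
    exact (iterate_negMap_mem β k).1.ne'

theorem iterate_sub_iterate {β x y : ℝ} {n : ℕ} (h : ∀ i < n, itin β x i = itin β y i) :
    (negMap β)^[n] y - (negMap β)^[n] x = (-β) ^ n * (y - x) := by
  induction n with
  | zero => simp
  | succ n ih =>
    have h1 := h n (by omega)
    simp only [itin] at h1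
    rw [Function.iterate_succ_apply', Function.iterate_succ_apply', negMap, negMap, h1, pow_succ']
    linear_combination (-β) * ih fun i hi => h i (by omega)

theorem negMap_iterate_mem (β : ℝ) {x : ℝ} (hx : x ∈ Set.Ioc (0 : ℝ) 1) (n : ℕ) :
    (negMap β)^[n] x ∈ Set.Ioc (0 : ℝ) 1 := by
  cases n with
  | zero => exact hx
  | succ n => rw [Function.iterate_succ_apply']; exact negMap_mem _ _

/-- The itinerary is increasing with respect to the alternating order. -/
theorem altLT_itin {β x y : ℝ} (hβ : 1 < β) (hx : x ∈ Set.Ioc (0 : ℝ) 1)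
    (hy : y ∈ Set.Ioc (0 : ℝ) 1) (hxy : x < y) : AltLT (itin β x) (itin β y) := by
  have hne : itin β x ≠ itin β y := by
    intro he
    obtain ⟨n, hn⟩ := pow_unbounded_of_one_lt (1 / (y - x)) hβ
    rw [div_lt_iff₀ (by linarith)] at hn
    have h1 := congrArg abs (iterate_sub_iterate (n := n) fun i _ => congrFun he i)
    rw [abs_mul, abs_pow, abs_neg, abs_of_pos (by linarith : 0 < β),
      abs_of_pos (by linarith : 0 < y - x)] at h1
    have h2 := negMap_iterate_mem β hx n
    have h3 := negMap_iterate_mem β hy n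
    have : |(negMap β)^[n] y - (negMap β)^[n] x| < 1 :=
      abs_lt.2 ⟨by linarith [h2.2, h3.1], by linarith [h3.2, h2.1]⟩
    linarith
  obtain ⟨k, hk, hd⟩ := exists_first_ne hne
  refine ⟨k, hk, ?_⟩
  have h1 := iterate_sub_iterate hk
  have hp : 0 < β ^ k * (y - x) := mul_pos (by positivity) (by linarith)
  rcases Nat.even_or_odd k with h2 | h2
  · rw [h2.neg_pow] at h1
    exact Or.inl ⟨h2, lt_of_le_of_ne
      (Int.floor_le_floor (mul_le_mul_of_nonneg_left (by linarith) (by linarith))) hd⟩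
  · rw [h2.neg_pow] at h1
    exact Or.inr ⟨h2, lt_of_le_of_ne
      (Int.floor_le_floor (mul_le_mul_of_nonneg_left (by linarith) (by linarith))) hd.symm⟩

theorem tailsLE_itin {β : ℝ} (hβ : 1 < β) : TailsLE (itin β 1) := by
  intro k _
  rw [itin_shift]
  have h := iterate_negMap_mem β k
  rcases h.2.eq_or_lt with h1 | h1
  · rw [h1]; exact Or.inr rfl
  · exact Or.inl (altLT_itin hβ h (by simp) h1)

/-! ### Renormalization by φ. -/

/-- Under `negMap β`, the point `x` reads the word `w` and then arrives at `y`; the points strictly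
between `x` and `y` are smaller than `1`. -/
def Run (β : ℝ) : List ℤ → ℝ → ℝ → Prop
  | [], x, y => x = y
  | d :: w, x, y => ⌊β * x⌋ = d ∧ (w ≠ [] → negMap β x < 1) ∧ Run β w (negMap β x) y

theorem Run.append {β : ℝ} {v w : List ℤ} {x y z : ℝ} (h : Run β v x y) (hv : v ≠ []) (hy : y < 1)
    (h' : Run β w y z) : Run β (v ++ w) x z := by
  induction v generalizing x with
  | nil => exact absurd rfl hv
  | cons d v ih =>
    obtain ⟨h1, h2, h3⟩ := h
    rcases eq_or_ne v [] with rfl | hv'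
    · simp only [Run] at h3
      subst h3
      exact ⟨h1, fun _ => hy, h'⟩
    · exact ⟨h1, fun _ => h2 hv', ih h3 hv'⟩

theorem Run.iterate_eq {β : ℝ} {w : List ℤ} {x y : ℝ} (h : Run β w x y) :
    (negMap β)^[w.length] x = y := by
  induction w generalizing x with
  | nil => exact h
  | cons d w ih => exact ih h.2.2

theorem Run.iterate_lt {β : ℝ} {w : List ℤ} {x y : ℝ} (h : Run β w x y) {i : ℕ} (hi : 0 < i)
    (hi' : i < w.length) : (negMap β)^[i] x < 1 := by
  induction w generalizing x i with
  | nil => simp at hi'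
  | cons d w ih =>
    obtain ⟨i, rfl⟩ := Nat.exists_eq_succ_of_ne_zero hi.ne'
    rw [Function.iterate_succ_apply]
    simp only [List.length_cons] at hi'
    rcases Nat.eq_zero_or_pos i with rfl | hi1
    · exact h.2.1 (by rintro rfl; simp at hi')
    · exact ih h.2.2 hi1 (by omega)

theorem Run.startsWith_itin {β : ℝ} {w : List ℤ} {x y : ℝ} (h : Run β w x y) :
    StartsWith w (itin β x) := by
  induction w generalizing x with
  | nil => intro i hi; simp at hi
  | cons d w ih =>
    intro i hi
    cases i with
    | zero => exact h.1
    | succ i => exact ih h.2.2 i (by simpa using hi)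

theorem Run.startsWith_append {β : ℝ} {v w : List ℤ} {x y : ℝ} (h : Run β v x y)
    (h' : StartsWith w (itin β y)) : StartsWith (v ++ w) (itin β x) := by
  refine NegBeta.startsWith_append.2 ⟨h.startsWith_itin, ?_⟩
  rw [itin_shift, h.iterate_eq]
  exact h'

/-- The words `w₀` and `w₁` act on `(b, d)` and `(d, 1]` as the decreasing affine maps with slopes
`-β ^ |w₀|` and `-β ^ |w₁|` that send `b` and `d`, respectively, to `1`. -/
structure Renorm (β : ℝ) (w₀ w₁ : List ℤ) (b d : ℝ) : Prop where
  length_pos : 0 < w₀.length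
  length_le : w₀.length ≤ w₁.length
  lt_one : d < 1
  lt_disc : b < d
  -- Equivalently, the branch of `w₀` sends the endpoint `d` to `b`.
  scale : β ^ w₀.length * (d - b) = 1 - b
  lt_image : b < 1 - β ^ w₁.length * (1 - d)
  zero : ∀ x, b < x → x < d → Run β w₀ x (1 - β ^ w₀.length * (x - b))
  one : ∀ x, d < x → x ≤ 1 → Run β w₁ x (1 - β ^ w₁.length * (x - d))
  disc : Run β w₁ d 1 ∨ Run β (w₀ ++ w₀) d 1

/-- Level 0 consists of the two branches of `negMap β` itself, with digits 0 and 1 and discontinuity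
`1 / β`. -/
theorem renorm_zero {β : ℝ} (h1 : 1 < β) (h2 : β < 2) : Renorm β [0] [1] 0 (1 / β) := by
  have hb : (0 : ℝ) < β := by linarith
  have h3 : β * (1 / β) = 1 := by field_simp
  have h4 : 1 / β < 1 := by rw [div_lt_one hb]; exact h1
  have hone : ∀ x, 1 / β ≤ x → x ≤ 1 → Run β [1] x (1 - β ^ 1 * (x - 1 / β)) := by
    intro x hx1 hx2
    have hf : ⌊β * x⌋ = 1 := by
      rw [Int.floor_eq_iff]
      push_cast
      constructor <;> nlinarith
    refine ⟨hf, by simp, ?_⟩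
    simp only [Run, negMap, hf]
    push_cast
    linear_combination (-1) * h3
  refine ⟨by simp, by simp, h4, by positivity, ?_, ?_, ?_, fun x hx => hone x hx.le, Or.inl ?_⟩
  · simp [hb.ne']
  · simp only [List.length_singleton, pow_one]
    rw [mul_sub, h3]; linarith
  · intro x hx1 hx2
    have hf : ⌊β * x⌋ = 0 := by
      rw [Int.floor_eq_iff]
      push_cast
      constructor <;> nlinarith
    refine ⟨hf, by simp, ?_⟩
    simp only [Run, negMap, hf, List.length_singleton]
    push_cast
    ring
  · simpa using hone (1 / β) le_rfl h4.le

section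

variable {β : ℝ} {w₀ w₁ : List ℤ} {b d : ℝ}

theorem Renorm.pow_zero (h1 : 1 < β) (h : Renorm β w₀ w₁ b d) : 1 < β ^ w₀.length :=
  one_lt_pow₀ h1 h.length_pos.ne'

theorem Renorm.pow_one (h1 : 1 < β) (h : Renorm β w₀ w₁ b d) : 1 < β ^ w₁.length :=
  one_lt_pow₀ h1 (h.length_pos.trans_le h.length_le).ne'

theorem Renorm.ne_zero (h : Renorm β w₀ w₁ b d) : w₀ ≠ [] :=
  List.ne_nil_of_length_pos h.length_pos

theorem Renorm.ne_one (h : Renorm β w₀ w₁ b d) : w₁ ≠ [] :=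
  List.ne_nil_of_length_pos (h.length_pos.trans_le h.length_le)

/-- The relation `1 - d = (1 - b) (1 - 1 / β ^ |w₀|)`. -/
theorem Renorm.one_sub (h : Renorm β w₀ w₁ b d) :
    β ^ w₀.length * (1 - d) = (1 - b) * (β ^ w₀.length - 1) := by
  linear_combination (-1) * h.scale

/-- The image of `1` after `w₁` lies below the discontinuity. -/
theorem Renorm.image_lt (h1 : 1 < β) (h : Renorm β w₀ w₁ b d) :
    1 - β ^ w₁.length * (1 - d) < d := by
  nlinarith [h.pow_one h1, h.lt_one]

/-- The position of the image of `1` after `w₁ w₀ w₀` relative to the discontinuity. -/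
theorem Renorm.image_image_sub (h : Renorm β w₀ w₁ b d) :
    β ^ w₀.length * ((1 - β ^ w₀.length * (1 - β ^ w₀.length * (1 - β ^ w₁.length * (1 - d) - b)
      - b)) - d) = (1 - b) * (β ^ w₀.length - 1) *
        (1 + (β ^ w₀.length) ^ 2 - (β ^ w₀.length) ^ 2 * β ^ w₁.length) := by
  have h1 := h.one_sub
  have h2 := h.scale
  set p := β ^ w₀.length
  set q := β ^ w₁.length
  linear_combination (1 - p ^ 2 * q) * h1

/-- The new discontinuity is the point that `w₁` sends to `d`: to its left only `w₁` is read, to its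
right `w₁ w₀ w₀`. By `image_image_sub`, the hypothesis `hlt` says exactly that the image of 1 after
`w₁ w₀ w₀` stays above `d`, the new left endpoint. -/
theorem Renorm.succ (h1 : 1 < β) (h : Renorm β w₀ w₁ b d)
    (hlt : (β ^ w₀.length) ^ 2 * β ^ w₁.length < (β ^ w₀.length) ^ 2 + 1) :
    Renorm β w₁ (w₁ ++ (w₀ ++ w₀)) d (d + (1 - d) / β ^ w₁.length) := by
  have hp := h.pow_zero h1
  have hq := h.pow_one h1
  have hd := h.lt_one
  have hbd := h.lt_disc
  have hsc := h.scale
  have him := h.image_image_sub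
  have he := h.lt_image
  have he' := h.image_lt h1
  have hlen : β ^ (w₁ ++ (w₀ ++ w₀)).length = (β ^ w₀.length) ^ 2 * β ^ w₁.length := by
    rw [List.length_append, List.length_append, pow_add, pow_add]; ring
  have hpos : d < 1 - β ^ w₀.length * (1 - β ^ w₀.length * (1 - β ^ w₁.length * (1 - d) - b)
      - b) := by
    have h2 : 0 < (1 - b) * (β ^ w₀.length - 1) *
        (1 + (β ^ w₀.length) ^ 2 - (β ^ w₀.length) ^ 2 * β ^ w₁.length) :=
      mul_pos (mul_pos (by linarith) (by linarith)) (by linarith)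
    rw [← him] at h2
    have h3 := (mul_pos_iff_of_pos_left (by linarith : 0 < β ^ w₀.length)).1 h2
    linarith
  set p := β ^ w₀.length with hpdef
  set q := β ^ w₁.length with hqdef
  have hq0 : 0 < q := by linarith
  have hp0 : 0 < p := by linarith
  set δ := (1 - d) / q with hδ
  have hqδ : q * δ = 1 - d := by rw [hδ]; field_simp
  have hδ0 : 0 < δ := div_pos (by linarith) hq0
  have hδ1 : δ < 1 - d := by nlinarith
  have hfd : 1 - p * (1 - q * (1 - d) - b) < d := by
    by_contra hcon
    push Not at hcon
    have : p * (d - b) ≤ p * (1 - p * (1 - q * (1 - d) - b) - b) :=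
      mul_le_mul_of_nonneg_left (by linarith) hp0.le
    linarith
  have hlong : ∀ x, d + δ < x → x ≤ 1 →
      Run β (w₁ ++ (w₀ ++ w₀)) x (1 - p * (1 - p * (1 - q * (x - d) - b) - b)) := by
    intro x hx1 hx2
    have e1 : q * δ < q * (x - d) := mul_lt_mul_of_pos_left (by linarith) hq0
    have e2 : q * (x - d) ≤ q * (1 - d) := mul_le_mul_of_nonneg_left (by linarith) hq0.le
    have e3 : p * (1 - q * (1 - d) - b) ≤ p * (1 - q * (x - d) - b) :=
      mul_le_mul_of_nonneg_left (by linarith) hp0.le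
    have e4 : p * (1 - q * (x - d) - b) < p * (d - b) :=
      mul_lt_mul_of_pos_left (by linarith) hp0
    refine (h.one x (by linarith) hx2).append h.ne_one (by linarith) ?_
    refine (h.zero _ (by linarith) (by linarith)).append h.ne_zero (by linarith) ?_
    exact h.zero _ (by linarith) (by linarith)
  have hshort : ∀ x, d < x → x < d + δ → Run β w₁ x (1 - q * (x - d)) :=
    fun x hx1 hx2 => h.one x hx1 (by linarith)
  refine ⟨h.length_pos.trans_le h.length_le, by simp, by linarith, by linarith, ?_, ?_,
    hshort, ?_, ?_⟩
  · rw [← hqdef]; linarith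
  · rw [hlen]
    have : 1 - p ^ 2 * q * (1 - (d + δ)) =
        1 - p * (1 - p * (1 - q * (1 - d) - b) - b) := by
      linear_combination p ^ 2 * hqδ - p * hsc
    rw [this]; exact hpos
  · intro x hx1 hx2
    rw [hlen]
    have : 1 - p ^ 2 * q * (x - (d + δ)) = 1 - p * (1 - p * (1 - q * (x - d) - b) - b) := by
      linear_combination p ^ 2 * hqδ - p * hsc
    rw [this]; exact hlong x hx1 hx2
  -- The new discontinuity reads `w₁` and lands on the old one, so the two alternatives in `disc`
  -- are exchanged.
  · have h2 : Run β w₁ (d + δ) d := by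
      have h3 := h.one (d + δ) (by linarith) (by linarith)
      have h4 : 1 - q * (d + δ - d) = d := by linarith
      rw [← hqdef, h4] at h3
      exact h3
    rcases h.disc with h3 | h3
    · exact Or.inr (h2.append h.ne_one hd h3)
    · exact Or.inl (h2.append h.ne_one hd h3)

/-- A point between `b` and `1` reads `w₀` or `w₁`. -/
theorem Renorm.startsWith_or (h : Renorm β w₀ w₁ b d) {x : ℝ} (hx : b < x) (hx' : x ≤ 1) :
    StartsWith w₀ (itin β x) ∨ StartsWith w₁ (itin β x) := by
  rcases lt_trichotomy x d with h2 | rfl | h2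
  · exact Or.inl (h.zero x hx h2).startsWith_itin
  · rcases h.disc with h3 | h3
    · exact Or.inr h3.startsWith_itin
    · exact Or.inl (h3.startsWith_itin.of_prefix (List.prefix_append _ _))
  · exact Or.inr (h.one x h2 hx').startsWith_itin

/-- The words read by `1` when the renormalization stops. -/
theorem Renorm.final_words (h1 : 1 < β) (h : Renorm β w₀ w₁ b d)
    (hle : (β ^ w₀.length) ^ 2 + 1 ≤ (β ^ w₀.length) ^ 2 * β ^ w₁.length) :
    (∃ w y, Run β w 1 y ∧ w₁.length + 2 * w₀.length ≤ w.length) ∧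
    (StartsWith (w₁ ++ (w₀ ++ w₁)) (itin β 1) ∨
      (∃ s, (s = w₀ ∨ s = w₁) ∧
        StartsWith (w₁ ++ (w₀ ++ (w₀ ++ (w₀ ++ s)))) (itin β 1)) ∨
      ∃ s, (s = w₀ ∨ s = w₁) ∧
        StartsWith (w₁ ++ (w₀ ++ (w₀ ++ (w₁ ++ (w₁ ++ (w₀ ++ s)))))) (itin β 1)) := by
  have hp := h.pow_zero h1
  have hq := h.pow_one h1
  have hd := h.lt_one
  have hbd := h.lt_disc
  have hsc := h.scale
  have him := h.image_image_sub
  have he := h.lt_image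
  have he' := h.image_lt h1
  -- The renormalization stops because the image of 1 after `w₁ w₀ w₀` is not above `d`. Below, `e`,
  -- `f`, `g` are the images after `w₁`, `w₁ w₀`, `w₁ w₀ w₀` (computed with these branches).
  have hneg : 1 - β ^ w₀.length * (1 - β ^ w₀.length * (1 - β ^ w₁.length * (1 - d) - b)
      - b) ≤ d := by
    have h2 : (1 - b) * (β ^ w₀.length - 1) *
        (1 + (β ^ w₀.length) ^ 2 - (β ^ w₀.length) ^ 2 * β ^ w₁.length) ≤ 0 :=
      mul_nonpos_of_nonneg_of_nonpos (mul_nonneg (by linarith) (by linarith)) (by linarith)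
    rw [← him] at h2
    have h3 := nonpos_of_mul_nonpos_right h2 (by linarith : 0 < β ^ w₀.length)
    linarith
  have r1 := h.one 1 hd le_rfl
  have r2 := h.zero _ he he'
  set p := β ^ w₀.length with hpdef
  set q := β ^ w₁.length with hqdef
  have hp0 : 0 < p := by linarith
  set e := 1 - q * (1 - d) with hedef
  set f := 1 - p * (e - b) with hfdef
  set g := 1 - p * (f - b) with hgdef
  have hf1 : f < 1 := by
    have : 0 < p * (e - b) := mul_pos hp0 (by linarith)
    linarith
  have hfb : b < f := by
    have : p * (e - b) < p * (d - b) := mul_lt_mul_of_pos_left (by linarith) hp0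
    linarith
  have r12 : Run β (w₁ ++ w₀) 1 f := r1.append h.ne_one (by linarith) r2
  have hlen : w₁.length + 2 * w₀.length ≤ (w₁ ++ (w₀ ++ w₁)).length := by
    have := h.length_le
    simp only [List.length_append]; omega
  have r12ne : w₁ ++ w₀ ≠ [] := by simp [h.ne_one]
  rcases lt_trichotomy f d with hfd | hfd | hfd
  · have r3 := h.zero f hfb hfd
    rw [← hpdef, ← hgdef] at r3
    have hg1 : g < 1 := by
      have : 0 < p * (f - b) := mul_pos hp0 (by linarith)
      linarith
    have hgb : b < g := by
      have : p * (f - b) < p * (d - b) := mul_lt_mul_of_pos_left (by linarith) hp0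
      linarith
    have r123 : Run β (w₁ ++ (w₀ ++ w₀)) 1 g := by
      rw [← List.append_assoc]; exact r12.append r12ne hf1 r3
    refine ⟨⟨_, g, r123, by simp; omega⟩, Or.inr ?_⟩
    rcases hneg.lt_or_eq with hgd | hgd
    · have r4 := h.zero g hgb hgd
      rw [← hpdef] at r4
      have hh1 : 1 - p * (g - b) ≤ 1 := by
        have : 0 < p * (g - b) := mul_pos hp0 (by linarith)
        linarith
      have hhb : b < 1 - p * (g - b) := by
        have : p * (g - b) < p * (d - b) := mul_lt_mul_of_pos_left (by linarith) hp0
        linarith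
      rcases h.startsWith_or hhb hh1 with h5 | h5
      · exact Or.inl ⟨w₀, Or.inl rfl, by
          simpa using r123.startsWith_append (r4.startsWith_append h5)⟩
      · exact Or.inl ⟨w₁, Or.inr rfl, by
          simpa using r123.startsWith_append (r4.startsWith_append h5)⟩
    -- Here the orbit reaches `d`. If it then reads `w₁` it is back at 1 and repeats `w₁ w₀`.
    · rw [hgd] at r123
      rcases h.disc with h5 | h5
      · right
        rcases h.startsWith_or hfb hf1.le with h7 | h7
        · exact ⟨w₀, Or.inl rfl, by
            simpa using r123.startsWith_append (h5.startsWith_append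
              (r12.startsWith_append h7))⟩
        · exact ⟨w₁, Or.inr rfl, by
            simpa using r123.startsWith_append (h5.startsWith_append
              (r12.startsWith_append h7))⟩
      · left
        exact ⟨w₀, Or.inl rfl, by simpa using r123.startsWith_append h5.startsWith_itin⟩
  · rw [hfd] at r12 hf1
    rcases h.disc with h5 | h5
    · have r3 : Run β (w₁ ++ (w₀ ++ w₁)) 1 1 := by
        rw [← List.append_assoc]; exact r12.append r12ne hf1 h5
      exact ⟨⟨_, 1, r3, hlen⟩, Or.inl r3.startsWith_itin⟩
    · have r3 : Run β ((w₁ ++ w₀) ++ (w₀ ++ w₀)) 1 1 := r12.append r12ne hf1 h5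
      refine ⟨⟨_, 1, r3, by simp; omega⟩, Or.inr (Or.inl ⟨w₁, Or.inr rfl, ?_⟩)⟩
      simpa using r3.startsWith_append r1.startsWith_itin
  · have r3 : Run β (w₁ ++ (w₀ ++ w₁)) 1 (1 - q * (f - d)) := by
      rw [← List.append_assoc]; exact r12.append r12ne hf1 (h.one f hfd hf1.le)
    exact ⟨⟨_, _, r3, hlen⟩, Or.inl r3.startsWith_itin⟩

end

/-- For `1 < β < 2`, renormalization by `φ` stops after finitely many steps. -/
theorem exists_renorm_final {β : ℝ} (h1 : 1 < β) (h2 : β < 2) :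
    ∃ (n : ℕ) (b d : ℝ), Renorm β (phi^[n] [0]) (phi^[n] [1]) b d ∧
      (β ^ (phi^[n] [0]).length) ^ 2 + 1 ≤
        (β ^ (phi^[n] [0]).length) ^ 2 * β ^ (phi^[n] [1]).length := by
  by_contra! hcon
  have hall : ∀ n : ℕ, ∃ b d, Renorm β (phi^[n] [0]) (phi^[n] [1]) b d := by
    intro n
    induction n with
    | zero => exact ⟨_, _, renorm_zero h1 h2⟩
    | succ n ih =>
      obtain ⟨b, d, h⟩ := ih
      have := h.succ h1 (hcon n b d h)
      rw [phi_iter_succ_zero, phi_iter_succ_one]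
      exact ⟨_, _, this⟩
  -- For `β ^ n > 2` the word φⁿ(1) is so long that the inequality for a further step fails.
  obtain ⟨n, hn⟩ := pow_unbounded_of_one_lt 2 h1
  obtain ⟨b, d, h⟩ := hall n
  have h3 := hcon n b d h
  have h4 := h.pow_zero h1
  have h5 : β ^ n ≤ β ^ (phi^[n] [1]).length := pow_le_pow_right₀ h1.le (lt_length_phi_iter n).le
  nlinarith

/-- Itineraries of `1` are larger than `u`. -/
theorem aboveU_itin {β : ℝ} (h1 : 1 < β) : AboveU (itin β 1) := by
  rcases le_or_gt 2 β with h2 | h2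
  · refine ⟨0, by simp, Or.inl ⟨by simp, ?_⟩⟩
    have h3 : u 0 = 1 := (startsWith_u 0) 0 (by simp)
    have h4 : (2 : ℤ) ≤ itin β 1 0 := by
      rw [itin, Int.le_floor]; simpa using h2
    omega
  obtain ⟨n, b, d, h, hle⟩ := exists_renorm_final h1 h2
  have hu := startsWith_u_six n
  have hodd := odd_length_phi_iter n
  obtain ⟨hu1, hu⟩ := startsWith_append.1 hu
  obtain ⟨hu2, hu⟩ := startsWith_append.1 hu
  -- In blocks φⁿ(0), φⁿ(1), written as letters, the itinerary starts with 101, 1000s or 100110s,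
  -- while `u` starts with 100111. Each common block has odd length and reverses the order.
  rcases (h.final_words h1 hle).2 with hs | ⟨s, hs', hs⟩ | ⟨s, hs', hs⟩
  · obtain ⟨hs1, hs⟩ := startsWith_append.1 hs
    obtain ⟨hs2, hs⟩ := startsWith_append.1 hs
    refine altLT_of_prefix_odd hodd.2 (hu1.eq_of_lt hs1) ?_
    refine altLT_of_prefix_odd hodd.1 (hs2.eq_of_lt hu2) ?_
    refine altLT_of_phi_iter n (Or.inr rfl) hs (hu.of_prefix ?_)
    rw [← List.append_assoc]
    exact List.prefix_append _ _
  · obtain ⟨hs1, hs⟩ := startsWith_append.1 hs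
    obtain ⟨hs2, hs⟩ := startsWith_append.1 hs
    obtain ⟨hs3, hs⟩ := startsWith_append.1 hs
    obtain ⟨hu3, hu⟩ := startsWith_append.1 hu
    refine altLT_of_prefix_odd hodd.2 (hu1.eq_of_lt hs1) ?_
    refine altLT_of_prefix_odd hodd.1 (hs2.eq_of_lt hu2) ?_
    refine altLT_of_prefix_odd hodd.1 (hu3.eq_of_lt hs3) ?_
    rcases hs' with rfl | rfl
    · exact altLT_of_phi_iter n (Or.inl rfl) (hu.of_prefix (List.prefix_append _ _)) hs
    · exact altLT_of_phi_iter n (Or.inr rfl) (hu.of_prefix (List.prefix_append _ _)) hs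
  · obtain ⟨hs1, hs⟩ := startsWith_append.1 hs
    obtain ⟨hs2, hs⟩ := startsWith_append.1 hs
    obtain ⟨hs3, hs⟩ := startsWith_append.1 hs
    obtain ⟨hs4, hs⟩ := startsWith_append.1 hs
    obtain ⟨hs5, hs⟩ := startsWith_append.1 hs
    obtain ⟨hu3, hu⟩ := startsWith_append.1 hu
    obtain ⟨hu4, hu⟩ := startsWith_append.1 hu
    obtain ⟨hu5, hu⟩ := startsWith_append.1 hu
    refine altLT_of_prefix_odd hodd.2 (hu1.eq_of_lt hs1) ?_
    refine altLT_of_prefix_odd hodd.1 (hs2.eq_of_lt hu2) ?_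
    refine altLT_of_prefix_odd hodd.1 (hu3.eq_of_lt hs3) ?_
    refine altLT_of_prefix_odd hodd.2 (hs4.eq_of_lt hu4) ?_
    refine altLT_of_prefix_odd hodd.2 (hu5.eq_of_lt hs5) ?_
    rcases hs' with rfl | rfl
    · exact altLT_of_phi_iter n (Or.inl rfl) hu hs
    · exact altLT_of_phi_iter n (Or.inr rfl) hu hs

/-- The orbit of `1` under `negMap β` returns to `1` only after a time `m` with `β ^ m ≥ 2`. -/
theorem two_le_pow_of_iterate_eq_one {β : ℝ} (h1 : 1 < β) {m : ℕ} (hm : 1 ≤ m)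
    (h : (negMap β)^[m] 1 = 1) : 2 ≤ β ^ m := by
  rcases le_or_gt 2 β with h2 | h2
  · exact h2.trans (le_self_pow₀ h1.le (by omega))
  obtain ⟨n, b, d, hr, hle⟩ := exists_renorm_final h1 h2
  obtain ⟨w, y, hw, hlen⟩ := (hr.final_words h1 hle).1
  -- While `w` is being read, the orbit stays below 1.
  have h3 : w.length ≤ m := by
    by_contra! hcon
    exact (hw.iterate_lt (by omega) hcon).ne h
  have h4 := hr.pow_zero h1
  calc (2 : ℝ) ≤ (β ^ (phi^[n] [0]).length) ^ 2 * β ^ (phi^[n] [1]).length := by nlinarith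
    _ = β ^ ((phi^[n] [1]).length + 2 * (phi^[n] [0]).length) := by
      rw [pow_add, pow_mul' β 2]; ring
    _ ≤ β ^ m := pow_le_pow_right₀ h1.le (hlen.trans h3)

/-- An orbit of `1` in `[0, 1]` returns to `1` only after a time `m` with `β ^ m ≥ 2`. -/
theorem two_le_pow_of_orbit_eq_one {β : ℝ} (h1 : 1 < β) {a : ℕ → ℤ}
    (h : ∀ n, orbit β a n ∈ Set.Icc (0 : ℝ) 1) {m : ℕ} (hm : 1 ≤ m) (hm' : orbit β a m = 1) :
    2 ≤ β ^ m := by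
  classical
  by_cases hall : ∀ j ≤ m, orbit β a j = (negMap β)^[j] 1
  · exact two_le_pow_of_iterate_eq_one h1 hm (by rw [← hall m le_rfl, hm'])
  -- At the first departure from `negMap β`, the latter is at 1, so its bound on return times
  -- applies.
  push Not at hall
  have hfind := Nat.find_spec hall
  have hmin := fun j => Nat.find_min hall (m := j)
  set j := Nat.find hall
  obtain ⟨hjm, hj⟩ := hfind
  obtain ⟨i, hi⟩ : ∃ i, j = i + 1 :=
    Nat.exists_eq_succ_of_ne_zero fun h0 => hj (by rw [h0]; rfl)
  have h3 : orbit β a i = (negMap β)^[i] 1 := by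
    have := hmin i (by omega)
    push Not at this
    exact this (by omega)
  rw [hi] at hj hjm
  rcases orbit_step h3 (h (i + 1)) with h4 | h4
  · exact absurd h4.2 hj
  · exact (two_le_pow_of_iterate_eq_one h1 (by omega) h4.2.2).trans
      (pow_le_pow_right₀ h1.le hjm)

/-- For `β` close to `1`, the points of the orbit prescribed by `u` lie in `(0, 1)`. -/
theorem exists_orbit_u_mem (N : ℕ) :
    ∃ β : ℝ, 1 < β ∧ ∀ n, 1 ≤ n → n ≤ N → orbit β u n ∈ Set.Ioo (0 : ℝ) 1 := by
  -- At `β = 1` the inequality reads 1 < 2, so near 1 finitely many renormalization steps are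
  -- available.
  have hev : ∀ᶠ β : ℝ in 𝓝[>] 1, ∀ n < N + 1, (β ^ (phi^[n] [0]).length) ^ 2 *
      β ^ (phi^[n] [1]).length < (β ^ (phi^[n] [0]).length) ^ 2 + 1 := by
    refine Filter.Eventually.filter_mono nhdsWithin_le_nhds ?_
    refine (Filter.eventually_all_finite (Set.finite_lt_nat (N + 1))).2 fun n _ => ?_
    have hc : Continuous fun β : ℝ => (β ^ (phi^[n] [0]).length) ^ 2 + 1 -
        (β ^ (phi^[n] [0]).length) ^ 2 * β ^ (phi^[n] [1]).length := by fun_prop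
    have := (hc.tendsto 1).eventually (lt_mem_nhds (a := 0) (by simp))
    filter_upwards [this] with β hβ
    linarith
  have hlt : ∀ᶠ β : ℝ in 𝓝[>] 1, β < 2 :=
    Filter.Eventually.filter_mono nhdsWithin_le_nhds (gt_mem_nhds (by norm_num))
  obtain ⟨β, hβ, h2, h1⟩ := (hev.and (hlt.and self_mem_nhdsWithin)).exists
  have h1 : 1 < β := h1
  refine ⟨β, h1, fun n hn hnN => ?_⟩
  have hren : ∀ k ≤ N + 1, ∃ b d, Renorm β (phi^[k] [0]) (phi^[k] [1]) b d := by
    intro k hk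
    induction k with
    | zero => exact ⟨_, _, renorm_zero h1 h2⟩
    | succ k ih =>
      obtain ⟨b, d, h⟩ := ih (by omega)
      rw [phi_iter_succ_zero, phi_iter_succ_one]
      exact ⟨_, _, h.succ h1 (hβ k (by omega))⟩
  obtain ⟨b, d, h⟩ := hren (N + 1) le_rfl
  have hrun := h.one 1 h.lt_one le_rfl
  have hlen := lt_length_phi_iter (N + 1)
  have heq : orbit β u n = (negMap β)^[n] 1 := by
    rw [← orbit_itin]
    exact orbit_congr fun i hi =>
      (startsWith_u (N + 1)).eq_of_lt hrun.startsWith_itin i (by omega)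
  rw [heq]
  exact ⟨(iterate_negMap_mem β n).1, hrun.iterate_lt (by omega) (by omega)⟩

/-! ### Existence of a base. -/

/-- The point `x`, at time `n` of an orbit, lies outside `[0, 1]` on the side which shows that the
base is too large for the prescribed digits. -/
def OverAt (n : ℕ) (x : ℝ) : Prop := (Odd n ∧ x < 0) ∨ (Even n ∧ 1 < x)

/-- The point `x`, at time `n` of an orbit, lies outside `[0, 1]` on the side which shows that the
base is too small for the prescribed digits. -/
def UnderAt (n : ℕ) (x : ℝ) : Prop := (Even n ∧ x < 0) ∨ (Odd n ∧ 1 < x)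

theorem overAt_or_underAt {n : ℕ} {x : ℝ} (h : x ∉ Set.Icc (0 : ℝ) 1) :
    OverAt n x ∨ UnderAt n x := by
  rw [Set.mem_Icc, not_and_or, not_le, not_le] at h
  unfold OverAt UnderAt
  rcases Nat.even_or_odd n with h1 | h1 <;> tauto

theorem OverAt.notMem {n : ℕ} {x : ℝ} (h : OverAt n x) : x ∉ Set.Icc (0 : ℝ) 1 := by
  rintro ⟨h1, h2⟩
  rcases h with h | h <;> linarith [h.2]

theorem UnderAt.notMem {n : ℕ} {x : ℝ} (h : UnderAt n x) : x ∉ Set.Icc (0 : ℝ) 1 := by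
  rintro ⟨h1, h2⟩
  rcases h with h | h <;> linarith [h.2]

theorem OverAt.not_underAt {n : ℕ} {x : ℝ} (h : OverAt n x) : ¬ UnderAt n x := by
  rintro h'
  rcases h with h | h <;> rcases h' with h' | h'
  · exact Nat.not_even_iff_odd.2 h.1 h'.1
  · linarith [h.2, h'.2]
  · linarith [h.2, h'.2]
  · exact Nat.not_even_iff_odd.2 h'.1 h.1

/-- The orbit leaves `[0, 1]` for the first time at `n`. -/
def FirstExit (β : ℝ) (a : ℕ → ℤ) (n : ℕ) : Prop :=
  (∀ j < n, orbit β a j ∈ Set.Icc (0 : ℝ) 1) ∧ orbit β a n ∉ Set.Icc (0 : ℝ) 1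

theorem FirstExit.eq {β : ℝ} {a : ℕ → ℤ} {m n : ℕ} (hm : FirstExit β a m)
    (hn : FirstExit β a n) : m = n := by
  rcases lt_trichotomy m n with h | h | h
  · exact absurd (hn.1 m h) hm.2
  · exact h
  · exact absurd (hm.1 n h) hn.2

theorem exists_firstExit {β : ℝ} {a : ℕ → ℤ} (h : ¬ ∀ n, orbit β a n ∈ Set.Icc (0 : ℝ) 1) :
    ∃ n, FirstExit β a n := by
  classical
  push Not at h
  exact ⟨Nat.find h, fun j hj => not_not.1 (Nat.find_min h hj), Nat.find_spec h⟩

/-- After passing through `1` at time `j`, the orbit of a sequence that dominates its tails can leave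
`[0, 1]` only on the side determined by the parity of `j`. -/
theorem FirstExit.over_iff_of_eq_one {β : ℝ} {a : ℕ → ℤ} (ha : ∀ n, 0 ≤ a n) (hA : TailsLE a)
    {n : ℕ} (hn : FirstExit β a n) {j : ℕ} (hj : 0 < j) (hjn : j < n) (h1 : orbit β a j = 1) :
    (Even j → OverAt n (orbit β a n)) ∧ (Odd j → UnderAt n (orbit β a n)) := by
  induction hk : n - j using Nat.strong_induction_on generalizing j with
  | _ k ih =>
  set b : ℕ → ℤ := fun i => a (j + i) with hb
  have hshift := orbit_shift h1
  have hle : AltLE b a := hA j hj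
  -- If the tail copied `a` up to time `n`, the exit point would equal the earlier orbit point at
  -- time `n - j`.
  have hne : ∃ r, r < n - j ∧ b r ≠ a r := by
    by_contra! hcon
    have h2 := hshift (n - j)
    rw [orbit_congr (b := a) hcon, Nat.add_sub_cancel' hjn.le] at h2
    exact hn.2 (h2 ▸ hn.1 (n - j) (by omega))
  classical
  have hr := Nat.find_spec hne
  have hmin : ∀ i < Nat.find hne, b i = a i := fun i hi => by
    have := Nat.find_min hne hi
    push Not at this
    exact this (by omega)
  set r := Nat.find hne
  have heq : orbit β a (j + (r + 1)) = orbit β a (r + 1) + (b r - a r) := by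
    rw [← hshift, orbit_succ, orbit_succ, orbit_congr hmin]; ring
  have hin := hn.1 (r + 1) (by omega)
  have hdig := hle.altLT_at hmin hr.2
  rcases (by omega : j + (r + 1) = n ∨ j + (r + 1) < n) with hend | hend
  · have hout := hn.2
    rw [← hend] at hout ⊢
    rw [heq] at hout ⊢
    rcases hdig with ⟨hp, hlt⟩ | ⟨hp, hlt⟩
    · have hlt' : (b r : ℝ) + 1 ≤ a r := by exact_mod_cast hlt
      have hneg : orbit β a (r + 1) + (b r - a r) < 0 := by
        by_contra! hcon
        exact hout ⟨hcon, by linarith [hin.2]⟩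
      exact ⟨fun he => Or.inl ⟨he.add_odd hp.add_one, hneg⟩,
        fun ho => Or.inl ⟨ho.add_odd hp.add_one, hneg⟩⟩
    · have hlt' : (a r : ℝ) + 1 ≤ b r := by exact_mod_cast hlt
      have hpos : 1 < orbit β a (r + 1) + (b r - a r) := by
        by_contra! hcon
        exact hout ⟨by linarith [hin.1], hcon⟩
      exact ⟨fun he => Or.inr ⟨he.add hp.add_one, hpos⟩,
        fun ho => Or.inr ⟨ho.add_even hp.add_one, hpos⟩⟩
  · have hin2 := hn.1 _ hend
    rw [heq] at hin2
    rcases hdig with ⟨hp, hlt⟩ | ⟨hp, hlt⟩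
    · have hlt' : (b r : ℝ) + 1 ≤ a r := by exact_mod_cast hlt
      -- A smaller digit lowers the point by at least 1, so without an exit it is exactly 0. The
      -- next point is at least 1: an exit, or a visit to 1 at a time of the same parity as `j`.
      have hz : orbit β a (j + (r + 1)) = 0 := by rw [heq]; linarith [hin.2, hin2.1]
      have hnext : orbit β a (j + (r + 2)) = a (j + (r + 1)) + 1 := by
        show orbit β a (j + (r + 1) + 1) = _
        rw [orbit_succ, hz]; ring
      have hpar : Even (r + 2) := by simpa [Nat.even_add] using hp
      have hnn : (0 : ℝ) ≤ a (j + (r + 1)) := by exact_mod_cast ha _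
      rcases (by omega : j + (r + 2) = n ∨ j + (r + 2) < n) with hend' | hend'
      · have hout := hn.2
        rw [← hend', hnext] at hout ⊢
        have hpos : (1 : ℝ) < a (j + (r + 1)) + 1 := by
          by_contra! hcon
          exact hout ⟨by linarith, hcon⟩
        exact ⟨fun he => Or.inr ⟨he.add hpar, hpos⟩,
          fun ho => Or.inr ⟨ho.add_even hpar, hpos⟩⟩
      · have hin3 := hn.1 _ hend'
        have h4 : orbit β a (j + (r + 2)) = 1 := by
          rw [hnext] at hin3 ⊢
          linarith [hin3.2]
        have h5 := ih (n - (j + (r + 2))) (by omega) (j := j + (r + 2)) (by omega) hend' h4 rfl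
        exact ⟨fun he => h5.1 (he.add hpar), fun ho => h5.2 (ho.add_even hpar)⟩
    · have hlt' : (a r : ℝ) + 1 ≤ b r := by exact_mod_cast hlt
      -- A larger digit at odd `r` raises the point by at least 1, so without an exit it is 1, again
      -- at a time of the same parity as `j`.
      have h4 : orbit β a (j + (r + 1)) = 1 := by rw [heq]; linarith [hin.1, hin2.2]
      have h5 := ih (n - (j + (r + 1))) (by omega) (j := j + (r + 1)) (by omega) hend h4 rfl
      exact ⟨fun he => h5.1 (he.add hp.add_one), fun ho => h5.2 (ho.add_even hp.add_one)⟩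

theorem FirstExit.over_iff_of_eq_zero {β : ℝ} {a : ℕ → ℤ} (ha : ∀ n, 0 ≤ a n) (hA : TailsLE a)
    {n : ℕ} (hn : FirstExit β a n) {j : ℕ} (hjn : j < n) (h0 : orbit β a j = 0) :
    (Odd j → OverAt n (orbit β a n)) ∧ (Even j → UnderAt n (orbit β a n)) := by
  have hnext : orbit β a (j + 1) = a j + 1 := by rw [orbit_succ, h0]; ring
  have hnn : (0 : ℝ) ≤ a j := by exact_mod_cast ha _
  rcases (by omega : j + 1 = n ∨ j + 1 < n) with hend | hend
  · have hout := hn.2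
    rw [← hend, hnext] at hout ⊢
    have hpos : (1 : ℝ) < a j + 1 := by
      by_contra! hcon
      exact hout ⟨by linarith, hcon⟩
    exact ⟨fun ho => Or.inr ⟨ho.add_one, hpos⟩, fun he => Or.inr ⟨he.add_one, hpos⟩⟩
  · have hin := hn.1 _ hend
    have h1 : orbit β a (j + 1) = 1 := by
      rw [hnext] at hin ⊢
      linarith [hin.2]
    have h2 := hn.over_iff_of_eq_one ha hA (by omega) hend h1
    exact ⟨fun ho => h2.1 ho.add_one, fun he => h2.2 he.add_one⟩

theorem continuous_orbit (a : ℕ → ℤ) (n : ℕ) : Continuous fun β => orbit β a n := by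
  induction n with
  | zero => exact continuous_const
  | succ n ih => simp only [orbit_succ]; fun_prop

/-- The side on which the orbit leaves `[0, 1]` is locally constant in the base. -/
theorem eventually_exit {β : ℝ} {a : ℕ → ℤ} (ha : ∀ n, 0 ≤ a n) (hA : TailsLE a) {n : ℕ}
    (hn : FirstExit β a n) :
    ∀ᶠ γ in 𝓝 β, ∃ m, FirstExit γ a m ∧
      (OverAt n (orbit β a n) → OverAt m (orbit γ a m)) ∧
      (UnderAt n (orbit β a n) → UnderAt m (orbit γ a m)) := by
  have hev : ∀ᶠ γ in 𝓝 β, ∀ j < n + 1, (0 < orbit β a j → 0 < orbit γ a j) ∧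
      (orbit β a j < 1 → orbit γ a j < 1) ∧ (orbit β a j < 0 → orbit γ a j < 0) ∧
      (1 < orbit β a j → 1 < orbit γ a j) := by
    refine (Filter.eventually_all_finite (Set.finite_lt_nat (n + 1))).2 fun j _ => ?_
    have ht := (continuous_orbit a j).tendsto β
    refine Filter.Eventually.and ?_ (Filter.Eventually.and ?_ (Filter.Eventually.and ?_ ?_)) <;>
      refine Filter.eventually_imp_distrib_left.2 fun h => ?_
    · exact ht.eventually (lt_mem_nhds h)
    · exact ht.eventually (gt_mem_nhds h)
    · exact ht.eventually (gt_mem_nhds h)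
    · exact ht.eventually (lt_mem_nhds h)
  filter_upwards [hev] with γ hγ
  have hout : ¬ ∀ i, orbit γ a i ∈ Set.Icc (0 : ℝ) 1 := by
    intro hcon
    have h1 := hγ n (by omega)
    have h2 := hcon n
    have h3 := hn.2
    rw [Set.mem_Icc, not_and_or, not_le, not_le] at h3
    rcases h3 with h3 | h3
    · linarith [h1.2.2.1 h3, h2.1]
    · linarith [h1.2.2.2 h3, h2.2]
  obtain ⟨m, hm⟩ := exists_firstExit hout
  refine ⟨m, hm, ?_⟩
  have hmn : m ≤ n := by
    by_contra! hcon
    have h2 := hm.1 n hcon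
    have h1 := hγ n (by omega)
    have h3 := hn.2
    rw [Set.mem_Icc, not_and_or, not_le, not_le] at h3
    rcases h3 with h3 | h3
    · linarith [h1.2.2.1 h3, h2.1]
    · linarith [h1.2.2.2 h3, h2.2]
  have h1 := hγ m (by omega)
  rcases hmn.eq_or_lt with rfl | hlt
  · exact ⟨fun h => h.imp (fun h => ⟨h.1, h1.2.2.1 h.2⟩) fun h => ⟨h.1, h1.2.2.2 h.2⟩,
      fun h => h.imp (fun h => ⟨h.1, h1.2.2.1 h.2⟩) fun h => ⟨h.1, h1.2.2.2 h.2⟩⟩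
  · have hm0 : 0 < m := by
      rcases Nat.eq_zero_or_pos m with rfl | h
      · exact absurd (by simp [orbit_zero]) hm.2
      · exact h
    -- The orbit for `γ` can leave earlier only where the orbit for `β` touches 0 or 1. Such a visit
    -- already determines the side on which the latter leaves, and the two sides agree.
    have hin := hn.1 m hlt
    have h3 := hm.2
    rw [Set.mem_Icc, not_and_or, not_le, not_le] at h3
    rcases h3 with h3 | h3
    · have h0 : orbit β a m = 0 := by
        by_contra hcon
        linarith [h1.1 (lt_of_le_of_ne hin.1 (Ne.symm hcon))]
      have h4 := hn.over_iff_of_eq_zero ha hA hlt h0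
      rcases Nat.even_or_odd m with h5 | h5
      · exact ⟨fun h => absurd (h4.2 h5) h.not_underAt, fun _ => Or.inl ⟨h5, h3⟩⟩
      · exact ⟨fun _ => Or.inl ⟨h5, h3⟩, fun h => absurd h (h4.1 h5).not_underAt⟩
    · have h0 : orbit β a m = 1 := by
        by_contra hcon
        linarith [h1.2.1 (lt_of_le_of_ne hin.2 hcon)]
      have h4 := hn.over_iff_of_eq_one ha hA hm0 hlt h0
      rcases Nat.even_or_odd m with h5 | h5
      · exact ⟨fun _ => Or.inr ⟨h5, h3⟩, fun h => absurd h (h4.1 h5).not_underAt⟩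
      · exact ⟨fun h => absurd (h4.2 h5) h.not_underAt, fun _ => Or.inr ⟨h5, h3⟩⟩

/-- For `β` close to `1`, the orbit of a sequence above `u` leaves `[0, 1]` on the side which shows
that `β` is too small. -/
theorem exists_under {a : ℕ → ℤ} (hB : AboveU a) :
    ∃ β : ℝ, 1 < β ∧ ∃ n, FirstExit β a n ∧ UnderAt n (orbit β a n) := by
  obtain ⟨r, hr, hd⟩ := hB
  obtain ⟨β, hβ, h⟩ := exists_orbit_u_mem (r + 1)
  have h1 := h (r + 1) (by omega) le_rfl
  have heq : orbit β a (r + 1) = orbit β u (r + 1) + (a r - u r) := by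
    rw [orbit_succ, orbit_succ, orbit_congr (b := a) hr]; ring
  have hU : UnderAt (r + 1) (orbit β a (r + 1)) := by
    rw [heq]
    rcases hd with ⟨hp, hlt⟩ | ⟨hp, hlt⟩
    · have hlt' : (u r : ℝ) + 1 ≤ a r := by exact_mod_cast hlt
      exact Or.inr ⟨hp.add_one, by linarith [h1.1]⟩
    · have hlt' : (a r : ℝ) + 1 ≤ u r := by exact_mod_cast hlt
      exact Or.inl ⟨hp.add_one, by linarith [h1.2]⟩
  refine ⟨β, hβ, r + 1, ⟨fun j hj => ?_, hU.notMem⟩, hU⟩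
  rw [← orbit_congr fun i hi => hr i (by omega)]
  rcases Nat.eq_zero_or_pos j with rfl | hj0
  · simp [orbit_zero]
  · exact Set.Ioo_subset_Icc_self (h j hj0 (by omega))

/-- The base `a 0 + 2` sends 1 to -1 in one step. -/
theorem exists_over {a : ℕ → ℤ} (ha : ∀ n, 0 ≤ a n) :
    ∃ β : ℝ, 1 < β ∧ ∃ n, FirstExit β a n ∧ OverAt n (orbit β a n) := by
  have h0 : (0 : ℝ) ≤ a 0 := by exact_mod_cast ha 0
  have hO : OverAt 1 (orbit (a 0 + 2) a 1) := by
    refine Or.inl ⟨odd_one, ?_⟩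
    rw [orbit_succ, orbit_zero]; linarith
  refine ⟨a 0 + 2, by linarith, 1, ⟨fun j hj => ?_, hO.notMem⟩, hO⟩
  obtain rfl : j = 0 := by omega
  simp [orbit_zero]

/-- A sequence that dominates its tails and lies above `u` is realized by some base. -/
theorem exists_base {a : ℕ → ℤ} (ha : ∀ n, 0 ≤ a n) (hA : TailsLE a) (hB : AboveU a) :
    ∃ β : ℝ, 1 < β ∧ ∀ n, orbit β a n ∈ Set.Icc (0 : ℝ) 1 := by
  by_contra! hcon
  have hexit : ∀ β : ℝ, 1 < β → ∃ n, FirstExit β a n := fun β hβ =>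
    exists_firstExit fun hall => (hcon β hβ).elim fun n hn => hn (hall n)
  let O : Set ℝ := {β | ∃ n, FirstExit β a n ∧ OverAt n (orbit β a n)}
  let U : Set ℝ := {β | ∃ n, FirstExit β a n ∧ UnderAt n (orbit β a n)}
  have hO : IsOpen O := by
    refine isOpen_iff_mem_nhds.2 ?_
    rintro β ⟨n, hn, hx⟩
    filter_upwards [eventually_exit ha hA hn] with γ ⟨m, hm, h1, _⟩
    exact ⟨m, hm, h1 hx⟩
  have hU : IsOpen U := by
    refine isOpen_iff_mem_nhds.2 ?_
    rintro β ⟨n, hn, hx⟩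
    filter_upwards [eventually_exit ha hA hn] with γ ⟨m, hm, _, h1⟩
    exact ⟨m, hm, h1 hx⟩
  have hcover : Set.Ioi (1 : ℝ) ⊆ O ∪ U := by
    intro β hβ
    obtain ⟨n, hn⟩ := hexit β hβ
    exact (overAt_or_underAt hn.2).imp (fun h => ⟨n, hn, h⟩) fun h => ⟨n, hn, h⟩
  obtain ⟨β₁, h1, h1'⟩ := exists_over ha
  obtain ⟨β₂, h2, h2'⟩ := exists_under hB
  obtain ⟨β, -, ⟨n, hn, hx⟩, m, hm, hy⟩ :=
    isPreconnected_Ioi O U hO hU hcover ⟨β₁, h1, h1'⟩ ⟨β₂, h2, h2'⟩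
  obtain rfl := hn.eq hm
  exact hx.not_underAt hy

/-! ### Uniqueness of the base. -/

open Classical in
/-- The indicator of a proposition, as a real number. -/
def ind (p : Prop) : ℝ := if p then 1 else 0

theorem ind_true {p : Prop} (h : p) : ind p = 1 := by simp [ind, h]

theorem ind_false {p : Prop} (h : ¬ p) : ind p = 0 := by simp [ind, h]

theorem ind_nonneg (p : Prop) : 0 ≤ ind p := by unfold ind; split_ifs <;> norm_num

theorem ind_le_one (p : Prop) : ind p ≤ 1 := by unfold ind; split_ifs <;> norm_num

theorem ind_mono {p q : Prop} (h : p → q) : ind p ≤ ind q := by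
  by_cases hp : p
  · rw [ind_true hp, ind_true (h hp)]
  · rw [ind_false hp]; exact ind_nonneg q

theorem sum_range_ind_lt {N D : ℕ} (h : N ≤ D) : ∑ d ∈ Finset.range D, ind (d < N) = N := by
  induction D, h using Nat.le_induction with
  | base =>
    rw [Finset.sum_congr rfl fun d hd => ind_true (Finset.mem_range.1 hd)]
    simp
  | succ D h ih => rw [Finset.sum_range_succ, ih, ind_false (by omega), add_zero]

/-- The alternating sum of `z ^ k` over all `k` for which the point `t k` is larger than `y`. -/
def stepSum (z : ℝ) (t : ℕ → ℝ) (y : ℝ) : ℝ := ∑' k, (-z) ^ k * ind (y < t k)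

theorem abs_mul_ind_le {z : ℝ} (hz : 0 ≤ z) (k : ℕ) (p : Prop) : |(-z) ^ k * ind p| ≤ z ^ k := by
  rw [abs_mul, abs_pow, abs_neg, abs_of_nonneg hz, abs_of_nonneg (ind_nonneg p)]
  exact mul_le_of_le_one_right (by positivity) (ind_le_one p)

theorem summable_mul_ind {z : ℝ} (hz : 0 ≤ z) (hz1 : z < 1) (p : ℕ → Prop) :
    Summable fun k => (-z) ^ k * ind (p k) :=
  Summable.of_norm_bounded (summable_geometric_of_lt_one hz hz1) fun k => abs_mul_ind_le hz k _

theorem stepSum_of_one_le {z : ℝ} {t : ℕ → ℝ} (ht : ∀ k, t k ∈ Set.Icc (0 : ℝ) 1) {y : ℝ}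
    (hy : 1 ≤ y) : stepSum z t y = 0 := by
  have : ∀ k, (-z) ^ k * ind (y < t k) = 0 := fun k => by
    rw [ind_false (by linarith [(ht k).2]), mul_zero]
  rw [stepSum, tsum_congr this, tsum_zero]

theorem antitone_tsum_ind {c : ℕ → ℝ} (hc : ∀ k, 0 ≤ c k) (hs : Summable c) (t : ℕ → ℝ) :
    Antitone fun y => ∑' k, c k * ind (y < t k) := by
  have hsum : ∀ y, Summable fun k => c k * ind (y < t k) := fun y =>
    Summable.of_nonneg_of_le (fun k => mul_nonneg (hc k) (ind_nonneg _))
      (fun k => mul_le_of_le_one_right (hc k) (ind_le_one _)) hs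
  intro x y hxy
  exact (hsum y).tsum_le_tsum (fun k => mul_le_mul_of_nonneg_left
    (ind_mono fun h => hxy.trans_lt h) (hc k)) (hsum x)

/-- Separating even and odd `k` writes the step function as a difference of two decreasing
functions. -/
theorem intervalIntegrable_stepSum {z : ℝ} (hz : 0 ≤ z) (hz1 : z < 1) (t : ℕ → ℝ) (p q : ℝ) :
    IntervalIntegrable (stepSum z t) volume p q := by
  have hg := summable_geometric_of_lt_one hz hz1
  let e : ℕ → ℝ := fun k => z ^ k * ind (Even k)
  let o : ℕ → ℝ := fun k => z ^ k * ind (Odd k)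
  have he0 : ∀ k, 0 ≤ e k := fun k => mul_nonneg (by positivity) (ind_nonneg _)
  have ho0 : ∀ k, 0 ≤ o k := fun k => mul_nonneg (by positivity) (ind_nonneg _)
  have he : Summable e := Summable.of_nonneg_of_le he0
    (fun k => mul_le_of_le_one_right (by positivity) (ind_le_one _)) hg
  have ho : Summable o := Summable.of_nonneg_of_le ho0
    (fun k => mul_le_of_le_one_right (by positivity) (ind_le_one _)) hg
  have heq : stepSum z t = fun y => (∑' k, e k * ind (y < t k)) - ∑' k, o k * ind (y < t k) := by
    funext y
    rw [stepSum, ← Summable.tsum_sub]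
    · refine tsum_congr fun k => ?_
      rw [← sub_mul]
      congr 1
      simp only [e, o]
      rcases Nat.even_or_odd k with h | h
      · rw [ind_true h, ind_false (Nat.not_odd_iff_even.2 h), h.neg_pow]; ring
      · rw [ind_true h, ind_false (Nat.not_even_iff_odd.2 h), h.neg_pow]; ring
    · exact Summable.of_nonneg_of_le (fun k => mul_nonneg (he0 k) (ind_nonneg _))
        (fun k => mul_le_of_le_one_right (he0 k) (ind_le_one _)) he
    · exact Summable.of_nonneg_of_le (fun k => mul_nonneg (ho0 k) (ind_nonneg _))
        (fun k => mul_le_of_le_one_right (ho0 k) (ind_le_one _)) ho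
  rw [heq]
  exact ((antitone_tsum_ind he0 he t).intervalIntegrable).sub
    ((antitone_tsum_ind ho0 ho t).intervalIntegrable)

theorem tendsto_stepSum {z : ℝ} (hz : 0 ≤ z) (hz1 : z < 1) {t : ℕ → ℝ}
    (ht : ∀ k, t k ∈ Set.Icc (0 : ℝ) 1) :
    Tendsto (stepSum z t) (𝓝[<] 1) (𝓝 (∑' k, (-z) ^ k * ind (t k = 1))) := by
  refine tendsto_tsum_of_dominated_convergence (summable_geometric_of_lt_one hz hz1) (fun k => ?_)
    (Eventually.of_forall fun y k => abs_mul_ind_le hz k _)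
  refine Tendsto.congr' ?_ tendsto_const_nhds
  rcases (ht k).2.eq_or_lt with h | h
  · filter_upwards [self_mem_nhdsWithin] with y hy
    rw [ind_true h, ind_true (by rw [h]; exact hy)]
  · filter_upwards [nhdsWithin_le_nhds (lt_mem_nhds h)] with y hy
    rw [ind_false h.ne, ind_false (by linarith)]

/-- The sum of a step function over all preimages under `x ↦ -βx + d + 1`. -/
theorem sum_stepSum {β : ℝ} (hβ : 1 < β) {a : ℕ → ℤ} (ha : ∀ n, 0 ≤ a n)
    (h : ∀ n, orbit β a n ∈ Set.Icc (0 : ℝ) 1) {z : ℝ} (hz : 0 < z) (hz1 : z < 1)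
    (hs : HasSum (fun j => (-z) ^ j * ((a j : ℝ) + 1)) z⁻¹) {D : ℕ} (hD : β + 1 ≤ D) {x : ℝ}
    (hx : x ∈ Set.Ioo (0 : ℝ) 1) (hne : ∀ k, x ≠ orbit β a k) :
    ∑ d ∈ Finset.range D, stepSum z (orbit β a) ((d + 1 - x) / β) =
      z⁻¹ * stepSum z (orbit β a) x := by
  have hb : 0 < β := by linarith
  -- Below the point `orbit β a k` lie the preimages of `x` with digits less than `a k`, and the one
  -- with digit `a k` exactly when `x` exceeds the next orbit point, since the branches are
  -- decreasing.
  have hcount : ∀ k, ∑ d ∈ Finset.range D, ind (((d : ℝ) + 1 - x) / β < orbit β a k) =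
      (a k + 1) - ind (x < orbit β a (k + 1)) := by
    intro k
    obtain ⟨m, hm⟩ := Int.eq_ofNat_of_zero_le (ha k)
    have hm' : (a k : ℝ) = m := by rw [hm]; simp
    have h1 := h k
    have h2 := h (k + 1)
    have hstep : β * orbit β a k = m + 1 - orbit β a (k + 1) := by rw [orbit_succ, hm']; ring
    have hle : β * orbit β a k ≤ β := mul_le_of_le_one_right hb.le h1.2
    have hiff : ∀ d : ℕ, (((d : ℝ) + 1 - x) / β < orbit β a k ↔
        (d : ℝ) < m + x - orbit β a (k + 1)) := fun d => by
      rw [div_lt_iff₀' hb, hstep]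
      constructor <;> intro h <;> linarith
    simp only [hiff]
    have hmD : m + 1 ≤ D := by
      have : ((m + 1 : ℕ) : ℝ) ≤ D := by push_cast; linarith [h2.2]
      exact_mod_cast this
    rcases lt_or_gt_of_ne (hne (k + 1)) with hlt | hlt
    · rw [ind_true hlt, hm']
      have : ∀ d : ℕ, ((d : ℝ) < m + x - orbit β a (k + 1) ↔ d < m) := fun d => by
        constructor
        · intro h
          have : (d : ℝ) < m := by linarith
          exact_mod_cast this
        · intro h
          have : (d : ℝ) + 1 ≤ m := by exact_mod_cast h
          linarith [hx.1, h2.2]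
      simp only [this]
      rw [sum_range_ind_lt (by omega)]; ring
    · rw [ind_false (not_lt.2 hlt.le), hm']
      have : ∀ d : ℕ, ((d : ℝ) < m + x - orbit β a (k + 1) ↔ d < m + 1) := fun d => by
        constructor
        · intro h
          have : (d : ℝ) < ((m + 1 : ℕ) : ℝ) := by push_cast; linarith [hx.2, h2.1]
          exact_mod_cast this
        · intro h
          have : (d : ℝ) ≤ m := by exact_mod_cast Nat.lt_succ_iff.1 h
          linarith
      simp only [this]
      rw [sum_range_ind_lt hmD]; push_cast; ring
  have hsum1 := summable_mul_ind hz.le hz1 fun k => x < orbit β a (k + 1)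
  have hsum0 := summable_mul_ind hz.le hz1 fun k => x < orbit β a k
  have hG : stepSum z (orbit β a) x = 1 + -z * ∑' k, (-z) ^ k * ind (x < orbit β a (k + 1)) := by
    rw [stepSum, hsum0.tsum_eq_zero_add, ← tsum_mul_left]
    congr 1
    · rw [orbit_zero, ind_true hx.2]; simp
    · exact tsum_congr fun k => by rw [pow_succ']; ring
  calc ∑ d ∈ Finset.range D, stepSum z (orbit β a) ((d + 1 - x) / β)
      = ∑' k, ∑ d ∈ Finset.range D,
          (-z) ^ k * ind (((d : ℝ) + 1 - x) / β < orbit β a k) :=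
        (Summable.tsum_finsetSum fun d _ => summable_mul_ind hz.le hz1 _).symm
    _ = ∑' k, ((-z) ^ k * (a k + 1) - (-z) ^ k * ind (x < orbit β a (k + 1))) :=
        tsum_congr fun k => by rw [← Finset.mul_sum, hcount, mul_sub]
    _ = z⁻¹ - ∑' k, (-z) ^ k * ind (x < orbit β a (k + 1)) := by
        rw [hs.summable.tsum_sub hsum1, hs.tsum_eq]
    _ = z⁻¹ * stepSum z (orbit β a) x := by
        rw [hG]; field_simp; ring

/-- By `sum_stepSum`, summing over preimages multiplies the step function by `z⁻¹ > β`, whereas it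
increases the integral of the absolute value by a factor of at most `β`. -/
theorem integral_abs_stepSum_eq_zero {β : ℝ} (hβ : 1 < β) {a : ℕ → ℤ} (ha : ∀ n, 0 ≤ a n)
    (h : ∀ n, orbit β a n ∈ Set.Icc (0 : ℝ) 1) {z : ℝ} (hz : 0 < z) (hzβ : z * β < 1)
    (hs : HasSum (fun j => (-z) ^ j * ((a j : ℝ) + 1)) z⁻¹) :
    ∫ x in (0 : ℝ)..1, |stepSum z (orbit β a) x| = 0 := by
  have hb : 0 < β := by linarith
  have hz1 : z < 1 := by nlinarith
  set G := stepSum z (orbit β a) with hGdef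
  obtain ⟨D, hD⟩ := exists_nat_ge (β + 1)
  have hint : ∀ p q, IntervalIntegrable (fun x => |G x|) volume p q := fun p q =>
    (intervalIntegrable_stepSum hz.le hz1 _ p q).abs
  have hintd : ∀ p q, IntervalIntegrable (fun x => |G (x / β)|) volume p q := fun p q => by
    have := (hint (p / β) (q / β)).comp_mul_right (c := β⁻¹)
    simpa [div_eq_mul_inv, hb.ne'] using this
  have hints : ∀ d : ℕ, IntervalIntegrable (fun x => |G ((d + 1 - x) / β)|) volume 0 1 :=
    fun d => by
      have := (hintd (d + 1) d).comp_sub_left ((d : ℝ) + 1)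
      simpa using this
  have hle : ∫ x in (0 : ℝ)..1, z⁻¹ * |G x| ≤
      ∫ x in (0 : ℝ)..1, ∑ d ∈ Finset.range D, |G ((d + 1 - x) / β)| := by
    refine intervalIntegral.integral_mono_ae_restrict zero_le_one ((hint 0 1).const_mul _) ?_ ?_
    · have := IntervalIntegrable.sum (Finset.range D) fun d _ => hints d
      exact this.congr fun x _ => by simp
    · have hc : (Set.range (orbit β a) ∪ {0, 1}).Countable :=
        (Set.countable_range _).union (Set.toFinite _).countable
      have h0 : ∀ᵐ x ∂(volume : Measure ℝ), x ∉ Set.range (orbit β a) ∪ {0, 1} :=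
        hc.ae_notMem volume
      filter_upwards [ae_restrict_of_ae h0, ae_restrict_mem measurableSet_Icc] with x hx hx'
      simp only [Set.mem_union, Set.mem_range, Set.mem_insert_iff, Set.mem_singleton_iff, not_or,
        not_exists] at hx
      have h1 := sum_stepSum hβ ha h hz hz1 hs hD (x := x)
        ⟨lt_of_le_of_ne hx'.1 (Ne.symm hx.2.1), lt_of_le_of_ne hx'.2 hx.2.2⟩
        fun k => Ne.symm (hx.1 k)
      calc z⁻¹ * |G x| = |z⁻¹ * G x| := by rw [abs_mul, abs_of_pos (inv_pos.2 hz)]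
        _ ≤ _ := by rw [← h1]; exact Finset.abs_sum_le_sum_abs _ _
  -- The branches tile [0, D / β], and the step function vanishes from 1 on.
  have hR : ∫ x in (0 : ℝ)..1, ∑ d ∈ Finset.range D, |G ((d + 1 - x) / β)| =
      β * ∫ x in (0 : ℝ)..1, |G x| := by
    rw [intervalIntegral.integral_finsetSum fun d _ => hints d]
    have h1 : ∀ d : ℕ, ∫ x in (0 : ℝ)..1, |G ((d + 1 - x) / β)| =
        ∫ x in (d : ℝ)..((d + 1 : ℕ) : ℝ), |G (x / β)| := fun d => by
      have := intervalIntegral.integral_comp_sub_left (a := 0) (b := 1)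
        (fun x => |G (x / β)|) ((d : ℝ) + 1)
      rw [this]
      simp
    rw [Finset.sum_congr rfl fun d _ => h1 d,
      intervalIntegral.sum_integral_adjacent_intervals (a := fun d : ℕ => (d : ℝ))
        fun d _ => hintd _ _,
      intervalIntegral.integral_comp_div (fun x => |G x|) hb.ne',
      ← intervalIntegral.integral_add_adjacent_intervals (hint _ 1) (hint 1 _)]
    have h2 : ∫ x in (1 : ℝ)..(D / β), |G x| = 0 := by
      have h3 : (1 : ℝ) ≤ D / β := by rw [le_div_iff₀ hb]; linarith
      rw [intervalIntegral.integral_congr (g := fun _ => 0)]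
      · simp
      · intro x hx
        rw [Set.uIcc_of_le h3] at hx
        simp only [hGdef]
        rw [stepSum_of_one_le h hx.1, abs_zero]
    rw [h2]
    simp
  rw [hR, intervalIntegral.integral_const_mul] at hle
  have hnn : 0 ≤ ∫ x in (0 : ℝ)..1, |G x| :=
    intervalIntegral.integral_nonneg zero_le_one fun x _ => abs_nonneg _
  have h3 : β < z⁻¹ := by rw [lt_inv_comm₀ hb hz, inv_eq_one_div, lt_div_iff₀ hb]; exact hzβ
  nlinarith

/-- The sum is the left limit at 1 of a step function that takes the value 0 arbitrarily close to 1.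
-/
theorem tsum_ind_eq_zero {β : ℝ} (hβ : 1 < β) {a : ℕ → ℤ} (ha : ∀ n, 0 ≤ a n)
    (h : ∀ n, orbit β a n ∈ Set.Icc (0 : ℝ) 1) {z : ℝ} (hz : 0 < z) (hzβ : z * β < 1)
    (hs : HasSum (fun j => (-z) ^ j * ((a j : ℝ) + 1)) z⁻¹) :
    ∑' k, (-z) ^ k * ind (orbit β a k = 1) = 0 := by
  have hz1 : z < 1 := by nlinarith
  have hI := integral_abs_stepSum_eq_zero hβ ha h hz hzβ hs
  have hint : ∀ p q, IntervalIntegrable (fun x => |stepSum z (orbit β a) x|) volume p q :=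
    fun p q => (intervalIntegrable_stepSum hz.le hz1 _ p q).abs
  have hfreq : ∃ᶠ x in 𝓝[<] (1 : ℝ), stepSum z (orbit β a) x ∈ ({0} : Set ℝ) := by
    intro hcon
    obtain ⟨l, hl, hl'⟩ := (mem_nhdsLT_iff_exists_Ioo_subset' (zero_lt_one' ℝ)).1 hcon
    set l' := max l 0
    have hl1 : l' < 1 := max_lt hl zero_lt_one
    have hpos : 0 < ∫ x in l'..1, |stepSum z (orbit β a) x| :=
      intervalIntegral.intervalIntegral_pos_of_pos_on (hint _ _) (fun x hx => abs_pos.2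
        (hl' ⟨(le_max_left _ _).trans_lt hx.1, hx.2⟩)) hl1
    have hnn : 0 ≤ ∫ x in (0 : ℝ)..l', |stepSum z (orbit β a) x| :=
      intervalIntegral.integral_nonneg (le_max_right _ _) fun x _ => abs_nonneg _
    rw [← intervalIntegral.integral_add_adjacent_intervals (hint 0 l') (hint l' 1)] at hI
    linarith
  exact isClosed_singleton.mem_of_frequently_of_tendsto hfreq (tendsto_stepSum hz.le hz1 h)

/-- The weights are relative to a visit to 1 at `j`, and `e` counts the times already scanned since.
A return time `m` satisfies `β ^ m ≥ 2`, so `z ^ m ≤ z * β / 2`; the bound is the geometric series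
with this ratio. -/
theorem sum_ind_orbit_le {β : ℝ} (hβ : 1 < β) {a : ℕ → ℤ}
    (h : ∀ n, orbit β a n ∈ Set.Icc (0 : ℝ) 1) {z : ℝ} (hz : 0 < z) (hzβ : z * β < 1) (n : ℕ)
    (j e : ℕ) (hj : orbit β a j = 1) :
    ∑ i ∈ Finset.range n, z ^ (e + 1 + i) * ind (orbit β a (j + e + 1 + i) = 1) ≤
      z * β / (2 - z * β) := by
  have hb : 0 < β := by linarith
  induction n generalizing j e with
  | zero =>
    rw [Finset.range_zero, Finset.sum_empty]
    exact div_nonneg (by positivity) (by linarith)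
  | succ n ih =>
    rw [Finset.sum_range_succ']
    by_cases h1 : orbit β a (j + e + 1) = 1
    · have h2 := ih (j + e + 1) 0 h1
      have h3 : 2 ≤ β ^ (e + 1) := by
        refine two_le_pow_of_orbit_eq_one hβ (a := fun i => a (j + i)) (fun i => ?_) (by omega)
          ((orbit_shift hj _).trans h1)
        rw [orbit_shift hj]; exact h _
      have h4 : z ^ (e + 1) ≤ z * β / 2 := by
        have h5 : (z * β) ^ (e + 1) ≤ z * β :=
          pow_le_of_le_one (by positivity) hzβ.le (by omega)
        rw [mul_pow] at h5
        have h6 : z ^ (e + 1) * 2 ≤ z ^ (e + 1) * β ^ (e + 1) :=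
          mul_le_mul_of_nonneg_left h3 (by positivity)
        linarith
      have h7 : ∑ i ∈ Finset.range n, z ^ (e + 1 + (i + 1)) *
          ind (orbit β a (j + e + 1 + (i + 1)) = 1) = z ^ (e + 1) *
          ∑ i ∈ Finset.range n, z ^ (0 + 1 + i) *
            ind (orbit β a (j + e + 1 + 0 + 1 + i) = 1) := by
        rw [Finset.mul_sum]
        refine Finset.sum_congr rfl fun i _ => ?_
        rw [← mul_assoc, ← pow_add]
        congr 2
        · omega
        · congr 2; omega
      rw [h7, add_zero, add_zero, ind_true h1, mul_one]
      have h8 : z * β / (2 - z * β) = z * β / 2 * (z * β / (2 - z * β) + 1) := by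
        have : 2 - z * β ≠ 0 := by linarith
        field_simp; ring
      have h9 : 0 ≤ z * β / (2 - z * β) := div_nonneg (by positivity) (by linarith)
      calc _ ≤ z ^ (e + 1) * (z * β / (2 - z * β)) + z ^ (e + 1) := by gcongr
        _ = z ^ (e + 1) * (z * β / (2 - z * β) + 1) := by ring
        _ ≤ z * β / 2 * (z * β / (2 - z * β) + 1) := by gcongr
        _ = _ := h8.symm
    · rw [add_zero (j + e + 1), ind_false h1, mul_zero, add_zero]
      refine le_trans (le_of_eq ?_) (ih j (e + 1) hj)
      refine Finset.sum_congr rfl fun i _ => ?_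
      congr 2
      · omega
      · congr 2; omega

theorem tsum_ind_ne_zero {β : ℝ} (hβ : 1 < β) {a : ℕ → ℤ}
    (h : ∀ n, orbit β a n ∈ Set.Icc (0 : ℝ) 1) {z : ℝ} (hz : 0 < z) (hzβ : z * β < 1) :
    ∑' k, (-z) ^ k * ind (orbit β a k = 1) ≠ 0 := by
  have hz1 : z < 1 := by nlinarith
  rw [(summable_mul_ind hz.le hz1 _).tsum_eq_zero_add, orbit_zero, ind_true rfl, pow_zero, mul_one]
  have h1 : ‖∑' k, (-z) ^ (k + 1) * ind (orbit β a (k + 1) = 1)‖ ≤ z * β / (2 - z * β) := by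
    have heq : ∀ k, ‖(-z) ^ (k + 1) * ind (orbit β a (k + 1) = 1)‖ =
        z ^ (0 + 1 + k) * ind (orbit β a (0 + 0 + 1 + k) = 1) := fun k => by
      rw [norm_mul, norm_pow, norm_neg, Real.norm_of_nonneg hz.le,
        Real.norm_of_nonneg (ind_nonneg _)]
      congr 2
      · omega
      · congr 2; omega
    have hsum := ((summable_nat_add_iff 1).2
      (summable_mul_ind hz.le hz1 fun k => orbit β a k = 1)).norm
    refine (norm_tsum_le_tsum_norm hsum).trans
      (Real.tsum_le_of_sum_range_le (fun _ => norm_nonneg _) fun n => ?_)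
    rw [Finset.sum_congr rfl fun k _ => heq k]
    exact sum_ind_orbit_le hβ h hz hzβ n 0 0 rfl
  have h2 : z * β / (2 - z * β) < 1 := by rw [div_lt_one (by linarith)]; linarith
  intro h3
  rw [Real.norm_eq_abs, eq_neg_of_add_eq_zero_right h3, abs_neg, abs_one] at h1
  linarith

theorem hasSum_of_isBase {β : ℝ} {a : ℕ → ℤ} (ha : ∀ n, 0 ≤ a n) {M : ℤ} (hM : ∀ n, a n ≤ M)
    (h : IsBase β a) : HasSum (fun j => (-β⁻¹) ^ j * ((a j : ℝ) + 1)) (β⁻¹)⁻¹ := by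
  have hβ := h.1
  have hb : β ≠ 0 := by linarith
  have h1 : HasSum (term β a 0) (-1) := by
    have := (summable_term hβ ha hM 0).hasSum
    have h2 : ∑' j, term β a 0 j = -1 := by have := h.2.1; simp only [tailSum] at this; linarith
    rwa [h2] at this
  have h2 := h1.mul_left (-β)
  have h3 : (fun j => -β * term β a 0 j) = fun j => (-β⁻¹) ^ j * ((a j : ℝ) + 1) := by
    funext j
    rw [term, Nat.zero_add, pow_succ, ← inv_neg, inv_pow]
    field_simp
  rw [h3, mul_neg_one, neg_neg] at h2
  rwa [inv_inv]

theorem isBase_unique {β γ : ℝ} {a : ℕ → ℤ} (ha : ∀ n, 0 ≤ a n) {M : ℤ} (hM : ∀ n, a n ≤ M)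
    (hβ : IsBase β a) (hγ : IsBase γ a) : β = γ := by
  wlog hlt : β < γ generalizing β γ
  · rcases (not_lt.1 hlt).eq_or_lt with h | h
    · exact h.symm
    · exact (this hγ hβ h).symm
  have h1 := ((isBase_iff ha hM).1 hβ)
  have hg : 0 < γ := by linarith [hγ.1]
  have hz : γ⁻¹ * β < 1 := by rw [inv_mul_lt_iff₀ hg]; linarith
  exact absurd (tsum_ind_eq_zero h1.1 ha h1.2 (inv_pos.2 hg) hz (hasSum_of_isBase ha hM hγ))
    (tsum_ind_ne_zero h1.1 h1.2 (inv_pos.2 hg) hz)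

/-! ### The two conditions and visits to 0. -/

theorem length_pre (a : ℕ → ℤ) (k : ℕ) : (pre a k).length = k := by simp [pre]

theorem pre_succ (a : ℕ → ℤ) (k : ℕ) : pre a (k + 1) = pre a k ++ [a k] := by
  simp [pre, List.range_succ]

theorem pre_congr {a b : ℕ → ℤ} {k : ℕ} (h : ∀ i < k, a i = b i) : pre a k = pre b k :=
  List.map_congr_left fun i hi => h i (List.mem_range.1 hi)

theorem startsWith_pre {c x : ℕ → ℤ} {k : ℕ} : StartsWith (pre c k) x ↔ ∀ j < k, x j = c j := by
  constructor
  · intro h j hj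
    simpa [pre] using h j (by simpa [pre] using hj)
  · intro h j hj
    simpa [pre] using h j (by simpa [pre] using hj)

theorem startsWith_long {c x : ℕ → ℤ} {l : ℕ} {d e : ℤ} :
    StartsWith (pre c l ++ [d, e]) x ↔ (∀ j < l, x j = c j) ∧ x l = d ∧ x (l + 1) = e := by
  rw [startsWith_append, startsWith_pre, length_pre]
  refine and_congr_right fun _ => ⟨fun h => ⟨h 0 (by simp), h 1 (by simp)⟩, ?_⟩
  rintro ⟨h1, h2⟩ i hi
  simp only [List.length_cons, List.length_nil] at hi
  interval_cases i
  · exact h1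
  · exact h2

theorem periodic_pre {c : ℕ → ℤ} {k : ℕ} (hk : 0 < k) (n : ℕ) :
    periodic (pre c k) n = c (n % k) := by
  have h := Nat.mod_lt n hk
  simp [periodic, pre, h]

theorem map_Ico_eq_iff {a : ℕ → ℤ} {s t : ℕ} (h : s ≤ t) {v : List ℤ} :
    (List.Ico s t).map a = v ↔ t = s + v.length ∧ StartsWith v (fun i => a (s + i)) := by
  constructor
  · rintro rfl
    refine ⟨by simp; omega, fun i hi => ?_⟩
    simp [List.Ico]
  · rintro ⟨rfl, h'⟩
    refine List.ext_getElem (by simp) fun i h1 h2 => ?_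
    rw [← h' i h2]
    simp [List.Ico]

/-- The sequence `a` is a concatenation of the blocks `c₀ ⋯ c_l` and `c₀ ⋯ (c_l - 1) 0`, which begin
at the positions `p i`. -/
def Blocks (c : ℕ → ℤ) (l : ℕ) (a : ℕ → ℤ) (p : ℕ → ℕ) : Prop :=
  p 0 = 0 ∧ ∀ i, (p (i + 1) = p i + (l + 1) ∧ ∀ j < l + 1, a (p i + j) = c j) ∨
    (p (i + 1) = p i + (l + 2) ∧ (∀ j < l, a (p i + j) = c j) ∧ a (p i + l) = c l - 1 ∧
      a (p i + (l + 1)) = 0)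

theorem isConcat_iff_blocks {c a : ℕ → ℤ} {l : ℕ} :
    IsConcat {pre c (l + 1), pre c l ++ [c l - 1, 0]} a ↔ ∃ p, Blocks c l a p := by
  constructor
  · rintro ⟨p, h0, hp, h⟩
    refine ⟨p, h0, fun i => ?_⟩
    have hle := (hp (Nat.lt_succ_self i)).le
    rcases h i with h1 | h1
    · obtain ⟨h2, h3⟩ := (map_Ico_eq_iff hle).1 h1
      rw [length_pre] at h2
      exact Or.inl ⟨h2, startsWith_pre.1 h3⟩
    · obtain ⟨h2, h3⟩ := (map_Ico_eq_iff hle).1 h1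
      rw [List.length_append, length_pre] at h2
      exact Or.inr ⟨h2, startsWith_long.1 h3⟩
  · rintro ⟨p, h0, h⟩
    have hlt : ∀ i, p i < p (i + 1) := fun i => by
      rcases h i with h | h <;> omega
    refine ⟨p, h0, strictMono_nat_of_lt_succ hlt, fun i => ?_⟩
    rcases h i with h1 | h1
    · refine Or.inl ((map_Ico_eq_iff (hlt i).le).2 ⟨?_, startsWith_pre.2 h1.2⟩)
      rw [length_pre, h1.1]
    · refine Or.inr ((map_Ico_eq_iff (hlt i).le).2 ⟨?_, startsWith_long.2 h1.2⟩)
      rw [List.length_append, length_pre, h1.1]; rfl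

theorem exists_positions {P : ℕ → ℕ → Prop} {Q : ℕ → Prop} (h0 : Q 0)
    (h : ∀ s, Q s → ∃ t, Q t ∧ P s t) : ∃ p : ℕ → ℕ, p 0 = 0 ∧ ∀ i, P (p i) (p (i + 1)) := by
  choose! f hf using h
  have hQ : ∀ i, Q (f^[i] 0) := fun i => by
    induction i with
    | zero => exact h0
    | succ i ih => rw [Function.iterate_succ_apply']; exact (hf _ ih).1
  refine ⟨fun i => f^[i] 0, rfl, fun i => ?_⟩
  simp only [Function.iterate_succ_apply']
  exact (hf _ (hQ i)).2

/-- The part of an orbit in `[0, 1]` from one visit of `1` to the next one. -/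
theorem orbit_block {β : ℝ} {a : ℕ → ℤ} (ha : ∀ n, 0 ≤ a n)
    (h : ∀ n, orbit β a n ∈ Set.Icc (0 : ℝ) 1) {l : ℕ} (hl : (negMap β)^[l + 1] 1 = 1)
    (hmin : ∀ j < l, (negMap β)^[j + 1] 1 ≠ 1) {s : ℕ} (hs : orbit β a s = 1) :
    ((∀ j < l + 1, a (s + j) = itin β 1 j) ∧ orbit β a (s + (l + 1)) = 1) ∨
      (((∀ j < l, a (s + j) = itin β 1 j) ∧ a (s + l) = itin β 1 l - 1 ∧ a (s + (l + 1)) = 0) ∧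
        orbit β a (s + (l + 2)) = 1) := by
  set x : ℕ → ℤ := fun i => a (s + i) with hx
  have hsh := orbit_shift hs
  have hin : ∀ n, orbit β x n ∈ Set.Icc (0 : ℝ) 1 := fun n => by rw [hsh]; exact h _
  have hfollow : ∀ j ≤ l, orbit β x j = (negMap β)^[j] 1 ∧ ∀ i < j, x i = itin β 1 i := by
    intro j hj
    induction j with
    | zero => exact ⟨rfl, by simp⟩
    | succ j ih =>
      obtain ⟨h1, h2⟩ := ih (by omega)
      rcases orbit_step h1 (hin (j + 1)) with h3 | h3
      · refine ⟨h3.2, fun i hi => ?_⟩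
        rcases Nat.lt_succ_iff_lt_or_eq.1 hi with h4 | rfl
        · exact h2 i h4
        · exact h3.1
      · exact absurd h3.2.2 (hmin j (by omega))
  obtain ⟨h1, h2⟩ := hfollow l le_rfl
  rcases orbit_step h1 (hin (l + 1)) with h3 | h3
  · refine Or.inl ⟨fun j hj => ?_, ?_⟩
    · rcases Nat.lt_succ_iff_lt_or_eq.1 hj with h4 | rfl
      · exact h2 j h4
      · exact h3.1
    · rw [← hsh, h3.2, hl]
  · have h4 : orbit β x (l + 2) = x (l + 1) + 1 := by rw [orbit_succ, h3.2.1]; ring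
    have h5 := (hin (l + 2)).2
    have h6 : (0 : ℝ) ≤ x (l + 1) := by exact_mod_cast ha _
    have h7 : (x (l + 1) : ℝ) = 0 := by linarith
    refine Or.inr ⟨⟨h2, h3.1, by exact_mod_cast h7⟩, ?_⟩
    rw [← hsh, h4, h7, zero_add]

theorem itin_eq_mod {β : ℝ} {k : ℕ} (hk : (negMap β)^[k] 1 = 1) (n : ℕ) :
    itin β 1 n = itin β 1 (n % k) := by
  have h : Function.Periodic (itin β 1) k := fun i => by
    have := congrFun (itin_shift β 1 k) i
    rw [hk] at this
    rw [add_comm]; exact this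
  exact (h.map_mod_nat n).symm

/-- If the orbit realizing `a` visits `0`, then one of the two conditions on `a` fails. -/
theorem not_cond_of_orbit_eq_zero {β : ℝ} (hβ : 1 < β) {a : ℕ → ℤ} (ha : ∀ n, 0 ≤ a n)
    (h : ∀ n, orbit β a n ∈ Set.Icc (0 : ℝ) 1) {k : ℕ} (hk : orbit β a k = 0) :
    ¬ (Cond1 a ∧ Cond2 a) := by
  classical
  rintro ⟨hC, hD⟩
  -- Without a return to 1, the orbit would follow `negMap β` forever and never reach 0.
  have hret : ∃ l, (negMap β)^[l + 1] 1 = 1 := by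
    by_contra! hcon
    have hall : ∀ n, orbit β a n = (negMap β)^[n] 1 := fun n => by
      induction n with
      | zero => rfl
      | succ n ih =>
        rcases orbit_step ih (h (n + 1)) with h3 | h3
        · exact h3.2
        · exact absurd h3.2.2 (hcon n)
    have := (iterate_negMap_mem β k).1
    rw [← hall, hk] at this
    exact lt_irrefl _ this
  have hl := Nat.find_spec hret
  have hmin : ∀ j < Nat.find hret, (negMap β)^[j + 1] 1 ≠ 1 := fun j hj => Nat.find_min hret hj
  set l := Nat.find hret
  set b := itin β 1 with hb
  have hblock := fun s => orbit_block ha h hl hmin (s := s)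
  obtain ⟨p, h0, hp⟩ := exists_positions (Q := fun s => orbit β a s = 1)
    (P := fun s t => (t = s + (l + 1) ∧ ∀ j < l + 1, a (s + j) = b j) ∨
      (t = s + (l + 2) ∧ (∀ j < l, a (s + j) = b j) ∧ a (s + l) = b l - 1 ∧ a (s + (l + 1)) = 0))
    rfl fun s hs => (hblock s hs).elim (fun h1 => ⟨_, h1.2, Or.inl ⟨rfl, h1.1⟩⟩)
      fun h1 => ⟨_, h1.2, Or.inr ⟨rfl, h1.1⟩⟩
  have hcon : IsConcat {pre b (l + 1), pre b l ++ [b l - 1, 0]} a :=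
    isConcat_iff_blocks.2 ⟨p, h0, hp⟩
  have hper : periodic (pre b (l + 1)) = b := by
    funext n
    rw [periodic_pre (by omega), hb, ← itin_eq_mod hl]
  have hne : a ≠ b := by
    intro hab
    rw [hab, orbit_itin] at hk
    exact (iterate_negMap_mem β k).1.ne' hk
  have hu := aboveU_itin hβ
  -- The first block of `a` decides which condition fails: `b l` is `a l` after the short block and
  -- `a l + 1` after the long one.
  rcases hblock 0 rfl with ⟨h1, -⟩ | ⟨⟨h1, h2, -⟩, -⟩
  · have h1' : ∀ j < l + 1, a j = b j := fun j hj => by simpa using h1 j hj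
    have e1 : pre a (l + 1) = pre b (l + 1) := pre_congr h1'
    have e2 : pre a l = pre b l := pre_congr fun j hj => h1' j (by omega)
    have h3 := hC (l + 1) (by omega)
    rw [Nat.add_sub_cancel, e1, e2, h1' l (by omega), hper] at h3
    exact h3 hu ⟨hcon, hne⟩
  · have h1' : ∀ j < l, a j = b j := fun j hj => by simpa using h1 j hj
    rw [Nat.zero_add] at h2
    have e2 : pre a l = pre b l := pre_congr h1'
    have e3 : a l + 1 = b l := by rw [h2]; ring
    have h3 := hD (l + 1) (by omega)
    rw [Nat.add_sub_cancel, e3, pre_succ, e2, ← pre_succ, hper, h2, List.append_assoc,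
      List.singleton_append, Set.pair_comm] at h3
    exact h3 hu hcon

theorem eq_mod_of_blocks {a f : ℕ → ℤ} {p : ℕ → ℕ} {q : ℕ} (hq : 0 < q) (h0 : p 0 = 0)
    (hp : ∀ i, p (i + 1) = p i + q) (h : ∀ i, ∀ j < q, a (p i + j) = f j) (n : ℕ) :
    a n = f (n % q) := by
  have hpi : ∀ i, p i = q * i := fun i => by
    induction i with
    | zero => simpa using h0
    | succ i ih => rw [hp, ih]; ring
  rw [← h (n / q) _ (Nat.mod_lt n hq), hpi, Nat.div_add_mod]

theorem eq_of_periodic {x y : ℕ → ℤ} {q : ℕ} (hq : 0 < q) (hx : Function.Periodic x q)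
    (hy : Function.Periodic y q) (h : ∀ j < q, x j = y j) : x = y := by
  funext n
  rw [← hx.map_mod_nat, ← hy.map_mod_nat]
  exact h _ (Nat.mod_lt n hq)

theorem periodic_mod (c : ℕ → ℤ) (q : ℕ) : Function.Periodic (fun n => c (n % q)) q := fun n => by
  simp

theorem periodic_shift {x : ℕ → ℤ} {q : ℕ} (hx : Function.Periodic x q) (i : ℕ) :
    Function.Periodic (fun j => x (i + j)) q := fun j => by
  show x (i + (j + q)) = x (i + j)
  rw [← add_assoc]; exact hx _

/-- For a periodic sequence, it is enough to compare the tails within one period. -/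
theorem tailsLE_of_periodic {x : ℕ → ℤ} {q : ℕ} (hq : 0 < q) (hx : Function.Periodic x q)
    (h : ∀ i, 0 < i → i < q → AltLE (fun j => x (i + j)) x) : TailsLE x := by
  intro i _
  have heq : (fun j => x (i + j)) = fun j => x (i % q + j) := by
    funext j
    rw [← hx.map_mod_nat, ← hx.map_mod_nat (i % q + j), Nat.mod_add_mod]
  rw [heq]
  rcases Nat.eq_zero_or_pos (i % q) with h0 | h0
  · right; funext j; rw [h0, Nat.zero_add]
  · exact h _ h0 (Nat.mod_lt i hq)

/-- If the periodic sequence `(c₀ ⋯ c_l)^ω` is realizable and `a` is a concatenation of `c₀ ⋯ c_l`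
and `c₀ ⋯ (c_l - 1) 0` with at least one block of the second kind, then the orbit of `a` visits
`0`. -/
theorem exists_orbit_eq_zero {a c : ℕ → ℤ} {l : ℕ} {p : ℕ → ℕ} (hc : ∀ n, 0 ≤ c n)
    (hW : TailsLE fun n => c (n % (l + 1))) (hu : AltLT u fun n => c (n % (l + 1)))
    (ha : ∀ n, 0 ≤ a n) (hA : TailsLE a) (hp : Blocks c l a p)
    (hlong : ∃ i, (∀ j < l, a (p i + j) = c j) ∧ a (p i + l) = c l - 1) {β : ℝ}
    (hβ : IsBase β a) : ∃ k, 1 ≤ k ∧ orbit β a k = 0 := by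
  set W : ℕ → ℤ := fun n => c (n % (l + 1)) with hWdef
  obtain ⟨γ, hγ, hin⟩ := exists_base (a := W) (fun n => hc _) hW hu
  have hWle := hW.le_zero
  have hWbase := (isBase_iff (fun n => hc _) hWle).2 ⟨hγ, hin⟩
  -- By periodicity of `W`, its tail sums at `l + 1` and at 0 coincide.
  have hret : orbit γ W (l + 1) = 1 := by
    rw [← neg_tailSum_eq_orbit hγ (fun n => hc _) hWle hWbase.2.1, ← hWbase.2.1]
    congr 1
    refine tsum_congr fun j => ?_
    simp only [term]
    rw [Nat.zero_add, Nat.add_mod_left]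
  have hWj : ∀ j < l + 1, W j = c j := fun j hj => by simp only [hWdef, Nat.mod_eq_of_lt hj]
  have hpart : ∀ s, orbit γ a s = 1 → (∀ j < l, a (s + j) = c j) → ∀ j ≤ l,
      orbit γ a (s + j) = orbit γ W j := fun s hs h j hj => by
    rw [← orbit_shift hs]
    exact orbit_congr fun i hi => by rw [h i (by omega), hWj i (by omega)]
  have hnext : ∀ s, orbit γ a s = 1 → (∀ j < l, a (s + j) = c j) →
      orbit γ a (s + (l + 1)) = 1 + (a (s + l) - c l) := fun s hs h => by
    rw [← hret, ← add_assoc, orbit_succ, orbit_succ, hpart s hs h l le_rfl, hWj l (by omega)]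
    ring
  -- Every block leads from 1 to 1 inside [0, 1], the long one by way of 0. So `γ` is a base for `a`
  -- too.
  have hmain : ∀ i, orbit γ a (p i) = 1 ∧ ∀ n ≤ p i, orbit γ a n ∈ Set.Icc (0 : ℝ) 1 := by
    intro i
    induction i with
    | zero =>
      rw [hp.1]
      refine ⟨rfl, fun n hn => ?_⟩
      obtain rfl : n = 0 := by omega
      simp [orbit_zero]
    | succ i ih =>
      obtain ⟨h1, h2⟩ := ih
      have hsplit : (∀ j < l, a (p i + j) = c j) → ∀ n ≤ p i + l,
          orbit γ a n ∈ Set.Icc (0 : ℝ) 1 := fun h n hn => by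
        rcases le_or_gt n (p i) with h3 | h3
        · exact h2 n h3
        · obtain ⟨j, rfl⟩ := Nat.exists_eq_add_of_lt h3
          rw [add_assoc, hpart _ h1 h _ (by omega)]
          exact hin _
      rcases hp.2 i with ⟨h3, h4⟩ | ⟨h3, h4, h5, h6⟩
      · have h7 : ∀ j < l, a (p i + j) = c j := fun j hj => h4 j (by omega)
        have h8 := hnext _ h1 h7
        rw [h4 l (by omega), sub_self, add_zero] at h8
        rw [h3]
        refine ⟨h8, fun n hn => ?_⟩
        rcases (by omega : n ≤ p i + l ∨ n = p i + (l + 1)) with h9 | rfl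
        · exact hsplit h7 n h9
        · rw [h8]; simp
      · have h8 := hnext _ h1 h4
        rw [h5] at h8
        push_cast at h8
        have h8' : orbit γ a (p i + (l + 1)) = 0 := by rw [h8]; ring
        have h9 : orbit γ a (p i + (l + 2)) = 1 := by
          show orbit γ a (p i + (l + 1) + 1) = 1
          rw [orbit_succ, h8', h6]; simp
        rw [h3]
        refine ⟨h9, fun n hn => ?_⟩
        rcases (by omega : n ≤ p i + l ∨ n = p i + (l + 1) ∨ n = p i + (l + 2)) with h10 | rfl | rfl
        · exact hsplit h4 n h10
        · rw [h8']; simp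
        · rw [h9]; simp
  have hlt : ∀ i, p i < p (i + 1) := fun i => by
    rcases hp.2 i with h | h <;> omega
  have hbase : IsBase γ a := (isBase_iff ha hA.le_zero).2
    ⟨hγ, fun n => (hmain n).2 n ((strictMono_nat_of_lt_succ hlt).id_le n)⟩
  obtain rfl := isBase_unique ha hA.le_zero hβ hbase
  obtain ⟨i, h1, h2⟩ := hlong
  refine ⟨p i + (l + 1), by omega, ?_⟩
  rw [hnext _ (hmain i).1 h1, h2]
  push_cast; ring

/-- A sequence that violates the first condition has an orbit that visits `0`. -/
theorem exists_orbit_eq_zero_of_not_cond1 {a : ℕ → ℤ} (ha : ∀ n, 0 ≤ a n) (hA : TailsLE a)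
    {β : ℝ} (hβ : IsBase β a) (h : ¬ Cond1 a) : ∃ k, 1 ≤ k ∧ orbit β a k = 0 := by
  unfold Cond1 at h
  push Not at h
  obtain ⟨k, hk, hu, hcon, hne⟩ := h
  obtain ⟨l, rfl⟩ := Nat.exists_eq_add_of_le' hk
  rw [Nat.add_sub_cancel] at hcon
  obtain ⟨p, hp⟩ := isConcat_iff_blocks.1 hcon
  have hper : periodic (pre a (l + 1)) = fun n => a (n % (l + 1)) := by
    funext n; exact periodic_pre (by omega) n
  rw [hper] at hu hne
  set W : ℕ → ℤ := fun n => a (n % (l + 1)) with hW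
  have hWper : Function.Periodic W (l + 1) := periodic_mod a (l + 1)
  have hp1 : p 1 = l + 1 := by
    rcases hp.2 0 with h1 | h1
    · rw [h1.1, hp.1, Nat.zero_add]
    · have := h1.2.2.1
      rw [hp.1, Nat.zero_add] at this
      omega
  have hsecond : ∀ j < l, a (l + 1 + j) = a j := fun j hj => by
    rw [← hp1]
    rcases hp.2 1 with h1 | h1
    · exact h1.2 j (by omega)
    · exact h1.2.1 j hj
  -- The first block is short and the second starts with the same `l` letters. This is enough to
  -- transfer to `W` every comparison of tails within one period.
  have hagree : ∀ n < 2 * l + 1, W n = a n := fun n hn => by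
    rcases lt_or_ge n (l + 1) with h1 | h1
    · simp only [hW, Nat.mod_eq_of_lt h1]
    · obtain ⟨j, rfl⟩ := Nat.exists_eq_add_of_le h1
      rw [hsecond j (by omega)]
      simp only [hW, Nat.add_mod_left]
      rw [Nat.mod_eq_of_lt (by omega)]
  have hWA : TailsLE W := by
    refine tailsLE_of_periodic (by omega) hWper fun i hi hil => ?_
    by_cases heq : ∀ j < l + 1, W (i + j) = W j
    · exact Or.inr (eq_of_periodic (by omega) (periodic_shift hWper i) hWper heq)
    left
    obtain ⟨r, hr, hd⟩ := exists_first_ne (x := fun j => W (i + j)) (y := W)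
      fun hcon => heq fun j _ => congrFun hcon j
    have hrl : r < l + 1 := by
      by_contra! hcon
      exact heq fun j hj => hr j (by omega)
    have hr' : ∀ j < r, a (i + j) = a j := fun j hj => by
      rw [← hagree _ (by omega), ← hagree j (by omega)]; exact hr j hj
    have hd' : a (i + r) ≠ a r := by
      rw [← hagree _ (by omega), ← hagree r (by omega)]; exact hd
    refine ⟨r, hr, ?_⟩
    show (Even r ∧ W (i + r) < W r) ∨ (Odd r ∧ W r < W (i + r))
    rw [hagree _ (by omega), hagree r (by omega)]
    exact (hA i hi).altLT_at hr' hd'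
  refine exists_orbit_eq_zero ha hWA hu ha hA hp ?_ hβ
  by_contra! hcon
  have hshort : ∀ i, p (i + 1) = p i + (l + 1) ∧ ∀ j < l + 1, a (p i + j) = a j := fun i => by
    rcases hp.2 i with h1 | h1
    · exact h1
    · exact absurd h1.2.2.1 (hcon i h1.2.1)
  exact hne (funext fun n => eq_mod_of_blocks (by omega) hp.1 (fun i => (hshort i).1)
    (fun i => (hshort i).2) n)

theorem AltLE.drop_even {x y : ℕ → ℤ} (h : AltLE x y) {n : ℕ} (hn : Even n)
    (hxy : ∀ i < n, x i = y i) : AltLE (fun i => x (n + i)) fun i => y (n + i) := by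
  by_cases heq : (fun i => x (n + i)) = fun i => y (n + i)
  · exact Or.inr heq
  obtain ⟨r, hr, hd⟩ := exists_first_ne heq
  refine Or.inl ⟨r, hr, ?_⟩
  have h1 : ∀ i < n + r, x i = y i := fun i hi => by
    rcases lt_or_ge i n with h2 | h2
    · exact hxy i h2
    · obtain ⟨j, rfl⟩ := Nat.exists_eq_add_of_le h2
      exact hr j (by omega)
  have h2 := h.altLT_at h1 hd
  rcases h2 with ⟨h3, h4⟩ | ⟨h3, h4⟩
  · exact Or.inl ⟨(Nat.even_add.1 h3).1 hn, h4⟩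
  · refine Or.inr ⟨?_, h4⟩
    rw [← Nat.not_even_iff_odd] at h3 ⊢
    exact fun h5 => h3 (hn.add h5)

/-- Compare the tail at `i ≤ l` of `(a₀ ⋯ a_{l-1} (a_l + 1))^ω` with that sequence. -/
theorem tail_trichotomy {a c : ℕ → ℤ} {l : ℕ} (hA : TailsLE a) (hc : ∀ j < l, c j = a j)
    (hcl : c l = a l + 1) {i n : ℕ} (hi : 0 < i) (hin : i + n = l) :
    AltLT (fun j => c ((i + j) % (l + 1))) (fun j => c (j % (l + 1))) ∨
      (Even n ∧ (∀ j < n, a (i + j) = a j) ∧ a n = a l) ∨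
      (Even n ∧ ∀ j < n + 1, c ((i + j) % (l + 1)) = c (j % (l + 1))) := by
  have hW : ∀ j < l, c (j % (l + 1)) = a j := fun j hj => by
    rw [Nat.mod_eq_of_lt (by omega), hc j hj]
  have hWl : c (l % (l + 1)) = a l + 1 := by rw [Nat.mod_eq_of_lt (by omega), hcl]
  by_cases heq : ∀ j < n, a (i + j) = a j
  · have hWeq : ∀ j < n, c ((i + j) % (l + 1)) = c (j % (l + 1)) := fun j hj => by
      rw [hW _ (by omega), hW _ (by omega)]; exact heq j hj
    have hdig := (hA i hi).digit heq
    simp only [hin] at hdig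
    rcases Nat.even_or_odd n with hn | hn
    · have h1 := hdig.1 hn
      rcases h1.eq_or_lt with h2 | h2
      -- The exceptional case: the raised last letter makes this tail of the periodic sequence too
      -- large.
      · exact Or.inr (Or.inl ⟨hn, heq, h2.symm⟩)
      · rcases (by omega : a l + 1 < a n ∨ a l + 1 = a n) with h3 | h3
        · refine Or.inl ⟨n, hWeq, Or.inl ⟨hn, ?_⟩⟩
          simp only [hin]
          rw [hWl, hW n (by omega)]; exact h3
        · refine Or.inr (Or.inr ⟨hn, fun j hj => ?_⟩)
          rcases Nat.lt_succ_iff_lt_or_eq.1 hj with h4 | rfl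
          · exact hWeq j h4
          · rw [hin, hWl, hW j (by omega)]; exact h3
    · refine Or.inl ⟨n, hWeq, Or.inr ⟨hn, ?_⟩⟩
      simp only [hin]
      rw [hWl, hW n (by omega)]
      have := hdig.2 hn
      omega
  · left
    obtain ⟨r, hr, hd⟩ := exists_first_ne (x := fun j => a (i + j)) (y := a)
      fun hcon => heq fun j _ => congrFun hcon j
    have hrn : r < n := by
      by_contra! hcon
      exact heq fun j hj => hr j (by omega)
    refine ⟨r, fun j hj => ?_, ?_⟩
    · show c ((i + j) % (l + 1)) = c (j % (l + 1))
      rw [hW _ (by omega), hW _ (by omega)]; exact hr j hj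
    · show (Even r ∧ c ((i + r) % (l + 1)) < c (r % (l + 1))) ∨
        (Odd r ∧ c (r % (l + 1)) < c ((i + r) % (l + 1)))
      rw [hW _ (by omega), hW _ (by omega)]
      exact (hA i hi).altLT_at hr hd

/-- In the exceptional case of `tail_trichotomy`, the sequence `a` has the even period `n + 2`. -/
theorem periodic_of_tail_eq {a c : ℕ → ℤ} {l : ℕ} {p : ℕ → ℕ} (ha : ∀ n, 0 ≤ a n)
    (hA : TailsLE a) (hc : ∀ j < l, c j = a j) (hcl : c l = a l + 1) (hp : Blocks c l a p)
    {i n : ℕ} (hi : 0 < i) (hin : i + n = l) (hn : Even n) (heq : ∀ j < n, a (i + j) = a j)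
    (hal : a n = a l) : Function.Periodic a (n + 2) ∧ a (n + 1) = 0 := by
  -- A short block, with its raised last letter, would contain the start of a tail larger than `a`.
  have hlong : ∀ r, p (r + 1) = p r + (l + 2) ∧ (∀ j < l, a (p r + j) = c j) ∧
      a (p r + l) = c l - 1 ∧ a (p r + (l + 1)) = 0 := fun r => by
    rcases hp.2 r with h1 | h1
    · have h2 := (hA (p r + i) (by omega)).digit (n := n) fun j hj => by
        show a (p r + i + j) = a j
        rw [add_assoc, h1.2 _ (by omega), hc _ (by omega)]; exact heq j hj
      have h3 := h2.1 hn
      rw [add_assoc, hin, h1.2 l (by omega), hcl] at h3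
      omega
    · exact h1
  have hfirst : a (l + 1) = 0 := by
    have := (hlong 0).2.2.2
    rwa [hp.1, Nat.zero_add] at this
  have heq1 : ∀ j < n + 1, a (i + j) = a j := fun j hj => by
    rcases Nat.lt_succ_iff_lt_or_eq.1 hj with h4 | rfl
    · exact heq j h4
    · rw [hin, hal]
  have hnext : a (n + 1) = 0 := by
    have h1 := ((hA i hi).digit heq1).2 hn.add_one
    rw [← add_assoc, hin, hfirst] at h1
    exact le_antisymm h1 (ha _)
  have heq2 : ∀ j < n + 2, a (i + j) = a j := fun j hj => by
    rcases Nat.lt_succ_iff_lt_or_eq.1 hj with h4 | rfl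
    · exact heq1 j h4
    · rw [← add_assoc, hin, hfirst, hnext]
  have hper : Function.Periodic a (l + 2) := by
    have h1 := eq_mod_of_blocks (a := a) (q := l + 2) (f := a) (by omega) hp.1 (fun r => (hlong r).1)
      fun r j hj => by
        obtain ⟨-, h2, h3, h4⟩ := hlong r
        rcases (by omega : j < l ∨ j = l ∨ j = l + 1) with h5 | rfl | rfl
        · rw [h2 j h5, hc j h5]
        · rw [h3, hcl]; ring
        · rw [h4, hfirst]
    rw [show a = fun n => a (n % (l + 2)) from funext h1]
    exact periodic_mod a (l + 2)
  -- The period `l + 2` turns this into `a ≤` its tail at `n + 2`; with the opposite inequality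
  -- `hle'` the two coincide.
  have hle := (hA i hi).drop_even (n := n + 2) (by simpa [Nat.even_add] using hn) heq2
  have hle' := hA (n + 2) (by omega)
  have hsand : ∀ j, a (n + 2 + j) = a j := fun j => by
    induction j using Nat.strong_induction_on with
    | _ j ih =>
    have hsh : ∀ j', a (i + (n + 2 + j')) = a j' := fun j' => by
      rw [show i + (n + 2 + j') = j' + (l + 2) by omega]; exact hper j'
    have h1 := hle.digit (n := j) fun j' hj' => by
      show a (i + (n + 2 + j')) = a (n + 2 + j')
      rw [hsh, ih j' hj']
    have h2 := hle'.digit (n := j) ih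
    simp only [hsh] at h1
    rcases Nat.even_or_odd j with h3 | h3
    · exact le_antisymm (h2.1 h3) (h1.1 h3)
    · exact le_antisymm (h1.2 h3) (h2.2 h3)
  exact ⟨fun j => by rw [add_comm]; exact hsand j, hnext⟩

/-- In the last case of `tail_trichotomy` the tail at `i` shares `n + 1` letters with the periodic
sequence, an odd number, and then restarts that sequence. The question is thereby reversed into
comparing the tail at `n + 1` with the sequence, where the trichotomy applies again. -/
theorem tailsLE_or_exists_periodic {a c : ℕ → ℤ} {l : ℕ} (hA : TailsLE a)
    (hc : ∀ j < l, c j = a j) (hcl : c l = a l + 1) :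
    TailsLE (fun j => c (j % (l + 1))) ∨
      ∃ i n, 0 < i ∧ i + n = l ∧ Even n ∧ (∀ j < n, a (i + j) = a j) ∧ a n = a l := by
  by_cases hex : ∃ i n, 0 < i ∧ i + n = l ∧ Even n ∧ (∀ j < n, a (i + j) = a j) ∧ a n = a l
  · exact Or.inr hex
  left
  have htri : ∀ i n, 0 < i → i + n = l →
      AltLT (fun j => c ((i + j) % (l + 1))) (fun j => c (j % (l + 1))) ∨
      (Even n ∧ ∀ j < n + 1, c ((i + j) % (l + 1)) = c (j % (l + 1))) := fun i n hi hin => by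
    rcases tail_trichotomy hA hc hcl hi hin with h | h | h
    · exact Or.inl h
    · exact absurd ⟨i, n, hi, hin, h⟩ hex
    · exact Or.inr h
  have hWper := periodic_mod c (l + 1)
  refine tailsLE_of_periodic (by omega) hWper fun i hi hil => ?_
  obtain ⟨n, rfl⟩ := Nat.exists_eq_add_of_le (Nat.lt_succ_iff.1 hil)
  have hback : ∀ j, c ((i + (n + 1 + j)) % (i + n + 1)) = c (j % (i + n + 1)) := fun j => by
    rw [show i + (n + 1 + j) = j + (i + n + 1) by omega, Nat.add_mod_right]
  rcases htri i n hi rfl with h | ⟨hn, h⟩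
  · exact Or.inl h
  obtain ⟨m, rfl⟩ := Nat.exists_eq_add_of_le' hi
  rcases htri (n + 1) m (by omega) (by omega) with h' | ⟨-, h'⟩
  · left
    refine altLT_of_prefix_odd hn.add_one h ?_
    simp only [hback]
    exact h'
  · right
    refine eq_of_periodic (by omega) (periodic_shift hWper _) hWper fun j hj => ?_
    rcases lt_or_ge j (n + 1) with h1 | h1
    · exact h j h1
    · obtain ⟨t, rfl⟩ := Nat.exists_eq_add_of_le h1
      show c ((m + 1 + (n + 1 + t)) % _) = _
      rw [hback]
      exact (h' t (by omega)).symm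

/-- Descent on `l`: if the periodic sequence is not realizable, then `a` has period `n + 2` with `n
< l` and `a (n + 1) = 0`, so it consists of long blocks for the word of length `n + 1` with its last
letter raised. -/
theorem exists_orbit_eq_zero_of_blocks {a : ℕ → ℤ} (ha : ∀ n, 0 ≤ a n) (hA : TailsLE a)
    (hB : AboveU a) {β : ℝ} (hβ : IsBase β a) (l : ℕ) {c : ℕ → ℤ} {p : ℕ → ℕ}
    (hc : ∀ j ≠ l, c j = a j) (hcl : c l = a l + 1)
    (hu : AltLT u fun n => c (n % (l + 1))) (hp : Blocks c l a p) :
    ∃ k, 1 ≤ k ∧ orbit β a k = 0 := by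
  induction l using Nat.strong_induction_on generalizing c p with
  | _ l ih =>
  have hc' : ∀ j < l, c j = a j := fun j hj => hc j hj.ne
  have hcnn : ∀ n, 0 ≤ c n := fun n => by
    rcases eq_or_ne n l with rfl | h
    · rw [hcl]; linarith [ha n]
    · rw [hc n h]; exact ha n
  rcases tailsLE_or_exists_periodic hA hc' hcl with hW | ⟨i, n, hi, hin, hn, heq, hal⟩
  · refine exists_orbit_eq_zero hcnn hW hu ha hA hp ⟨0, ?_⟩ hβ
    rcases hp.2 0 with h1 | h1
    · have := h1.2 l (by omega)
      rw [hp.1, Nat.zero_add, hcl] at this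
      omega
    · exact ⟨h1.2.1, h1.2.2.1⟩
  · obtain ⟨hper, h0⟩ := periodic_of_tail_eq ha hA hc' hcl hp hi hin hn heq hal
    let e : ℕ → ℤ := Function.update a n (a n + 1)
    have he : ∀ j ≠ n, e j = a j := fun j hj => Function.update_of_ne hj _ _
    have hen : e n = a n + 1 := Function.update_self _ _ _
    refine ih n (by omega) (c := e) (p := fun r => r * (n + 2)) he hen ?_ ⟨by simp, fun r => ?_⟩
    -- Raising the letter at the even index `n` gives a sequence larger than `a`, hence larger than
    -- `u`.
    · refine hB.trans ⟨n, fun j hj => ?_, Or.inl ⟨hn, ?_⟩⟩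
      · simp only [Nat.mod_eq_of_lt (by omega : j < n + 1)]
        exact (he j hj.ne).symm
      · simp only [Nat.mod_eq_of_lt (by omega : n < n + 1)]
        rw [hen]; omega
    · have hmul : ∀ j, a (r * (n + 2) + j) = a j := fun j => by
        rw [add_comm]; exact hper.nat_mul r j
      refine Or.inr ⟨by ring, fun j hj => ?_, ?_, ?_⟩
      · rw [hmul, he j hj.ne]
      · rw [hmul, hen]; ring
      · rw [hmul, h0]

/-- A sequence that violates the second condition has an orbit that visits `0`. -/
theorem exists_orbit_eq_zero_of_not_cond2 {a : ℕ → ℤ} (ha : ∀ n, 0 ≤ a n) (hA : TailsLE a)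
    (hB : AboveU a) {β : ℝ} (hβ : IsBase β a) (h : ¬ Cond2 a) :
    ∃ k, 1 ≤ k ∧ orbit β a k = 0 := by
  unfold Cond2 at h
  push Not at h
  obtain ⟨k, hk, hu, hcon⟩ := h
  obtain ⟨l, rfl⟩ := Nat.exists_eq_add_of_le' hk
  rw [Nat.add_sub_cancel] at hu hcon
  let c : ℕ → ℤ := Function.update a l (a l + 1)
  have hc : ∀ j ≠ l, c j = a j := fun j hj => Function.update_of_ne hj _ _
  have hcl : c l = a l + 1 := Function.update_self _ _ _
  have hpre : pre c l = pre a l := pre_congr fun j hj => hc j hj.ne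
  have hword : pre a l ++ [a l + 1] = pre c (l + 1) := by rw [pre_succ, hpre, hcl]
  have hword' : pre a (l + 1) ++ [0] = pre c l ++ [c l - 1, 0] := by
    rw [pre_succ, hpre, hcl, List.append_assoc, add_sub_cancel_right]; rfl
  rw [hword] at hu hcon
  rw [hword', Set.pair_comm] at hcon
  obtain ⟨p, hp⟩ := isConcat_iff_blocks.1 hcon
  rw [show periodic (pre c (l + 1)) = fun n => c (n % (l + 1)) from
    funext fun n => periodic_pre (by omega) n] at hu
  exact exists_orbit_eq_zero_of_blocks ha hA hB hβ l hc hcl hu hp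

/-- A sequence that dominates its tails and lies above `u` is realized by a unique base; its orbit
avoids `0` exactly under the two conditions, and exactly if the sequence is an itinerary. -/
theorem exists_isBase {a : ℕ → ℤ} (ha : ∀ n, 0 ≤ a n) (hA : TailsLE a) (hB : AboveU a) :
    ∃ β : ℝ, IsBase β a ∧ (∀ γ : ℝ, IsBase γ a → γ = β) ∧ (∀ k : ℕ, Summable (term β a k)) ∧
      ((∀ k : ℕ, 1 ≤ k → tailSum β a k ≠ 0) ↔ Cond1 a ∧ Cond2 a) ∧
      ((∀ k : ℕ, 1 ≤ k → tailSum β a k ≠ 0) ↔ IsItinerary β a) := by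
  obtain ⟨β, h1, hin⟩ := exists_base ha hA hB
  have hM := hA.le_zero
  have hβ : IsBase β a := (isBase_iff ha hM).2 ⟨h1, hin⟩
  have htail : (∀ k : ℕ, 1 ≤ k → tailSum β a k ≠ 0) ↔ ∀ k, 1 ≤ k → orbit β a k ≠ 0 := by
    refine forall₂_congr fun k _ => ?_
    rw [← neg_tailSum_eq_orbit h1 ha hM hβ.2.1, neg_ne_zero]
  refine ⟨β, hβ, fun γ hγ => isBase_unique ha hM hγ hβ, summable_term h1 ha hM, ?_, ?_⟩
  · rw [htail]
    constructor
    · intro h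
      constructor <;> by_contra hcon
      · obtain ⟨k, hk, hk'⟩ := exists_orbit_eq_zero_of_not_cond1 ha hA hβ hcon
        exact h k hk hk'
      · obtain ⟨k, hk, hk'⟩ := exists_orbit_eq_zero_of_not_cond2 ha hA hB hβ hcon
        exact h k hk hk'
    · intro h k _ hk
      exact not_cond_of_orbit_eq_zero h1 ha hin hk h
  · rw [htail, orbit_ne_zero_iff hin]

end NegBeta

end

theorem mainTheorem4 (a : ℕ → ℤ) (ha : ∀ n, 0 ≤ a n) :
    (NegBeta.TailsLE a → NegBeta.AboveU a →
      ∃ β : ℝ,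
        NegBeta.IsBase β a ∧
        (∀ β' : ℝ, NegBeta.IsBase β' a → β' = β) ∧
        (∀ k : ℕ, Summable (NegBeta.term β a k)) ∧
        ((∀ k : ℕ, 1 ≤ k → NegBeta.tailSum β a k ≠ 0) ↔ NegBeta.Cond1 a ∧ NegBeta.Cond2 a) ∧
        ((∀ k : ℕ, 1 ≤ k → NegBeta.tailSum β a k ≠ 0) ↔ NegBeta.IsItinerary β a)) ∧
    ((∃ β : ℝ, 1 < β ∧ NegBeta.IsItinerary β a) ↔
      NegBeta.TailsLE a ∧ NegBeta.AboveU a ∧ NegBeta.Cond1 a ∧ NegBeta.Cond2 a) := by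
  refine ⟨NegBeta.exists_isBase ha, ?_, ?_⟩
  · rintro ⟨β, hβ, hit⟩
    have heq := NegBeta.isItinerary_iff.1 hit
    have hA : NegBeta.TailsLE a := heq ▸ NegBeta.tailsLE_itin hβ
    have hB : NegBeta.AboveU a := heq ▸ NegBeta.aboveU_itin hβ
    obtain ⟨γ, -, huniq, -, hcond, hitin⟩ := NegBeta.exists_isBase ha hA hB
    have hbase : NegBeta.IsBase β a := (NegBeta.isBase_iff ha hA.le_zero).2 ⟨hβ, fun n => by
      rw [heq, NegBeta.orbit_itin]
      exact Set.Ioc_subset_Icc_self (NegBeta.iterate_negMap_mem β n)⟩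
    obtain rfl := huniq β hbase
    exact ⟨hA, hB, hcond.1 (hitin.2 hit)⟩
  · rintro ⟨hA, hB, hcond⟩
    obtain ⟨β, hbase, -, -, h1, h2⟩ := NegBeta.exists_isBase ha hA hB
    exact ⟨β, hbase.1, h2.1 (h1.2 hcond)⟩
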